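/- Let $M$ be a smooth $n$-dimensional manifold (Hausdorff, second countable, without boundary), $\omega$ a volume form on $M$ (a nowhere vanishing smooth $n$-form), and $P$ a Poisson bivector on $M$, i.e. a smooth bivector field with $[\![P,P]\!]=0$. Conventions. Multivector fields $Q$ act on differential forms by insertion $i_Q\beta=Q\rfloor\beta$, where $X\rfloor\beta=\beta(X,\cdot,\dots,\cdot)$ for vector fields and $i_{Q\wedge R}=i_Q\circ i_R$. With $[\cdot,\cdot]^{gr}$ the graded commutator of operators on forms, $L_Q=[i_Q,d]^{gr}=i_Q d-(-1)^{\deg Q}d\,i_Q$, and the Schouten bracket is determined by $i_{[\![Q,R]\!]}=[L_Q,i_R]^{gr}$. For a bivector field $Q$ and $f\in C^\infty(M)$ the Hamiltonian vector field is $Q_f=[\![Q,f]\!]=-df\rfloor Q$, where $df\rfloor(X\wedge Y)=X(f)Y-Y(f)X$; $f$ is a Casimir function of $Q$ if $Q_f=0$. Two Poisson bivectors are compatible if their sum is a Poisson bivector. A Poisson bivector $Q$ is $\omega$-unimodular if $L_Q\omega=0$. The $\omega$-modular vector field of $P$ is the vector field $\Xi$ with $\Xi\rfloor\omega=d(P\rfloor\omega)$.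 Let $\Xi$ be the $\omega$-modular vector field of $P$ and let $\nu\in C^\infty(M)$ satisfy $\Xi(\nu)=1$ on $M$. Then: 1. $\Xi\wedge P_\nu$ is a Poisson bivector compatible with $P$; 2. $L_{\Xi\wedge P_\nu}\omega=-L_P\omega$; 3. $P+\Xi\wedge P_\nu$ is an $\omega$-unimodular Poisson bivector compatible with $P$, and $\nu$ is a Casimir function of $P+\Xi\wedge P_\nu$; 4. $P_\nu\wedge\Xi=[\![P,\nu\Xi]\!]$. -/

import Mathlib

open scoped Manifold ContDiff

noncomputable section

namespace ModularPoisson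

/-! ### Linear algebra: inserting multivectors into alternating forms -/

section Insertion

/-- Inhomogeneous exterior forms on `V`: a family `(β₀, β₁, …)` with `βₖ` an alternating `k`-form. -/
abbrev ExtForm (V : Type*) [AddCommGroup V] [Module ℝ V] [TopologicalSpace V] : Type _ :=
  ∀ k : ℕ, V [⋀^Fin k]→L[ℝ] ℝ

/-- `v ⌋ β = β(v, ·, …, ·)` for a `(k+1)`-form `β`. -/
def insertVector {V : Type*} [AddCommGroup V] [Module ℝ V] [TopologicalSpace V]
    {k : ℕ} (v : V) (β : V [⋀^Fin (k + 1)]→L[ℝ] ℝ) : V [⋀^Fin k]→L[ℝ] ℝ :=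
  { β.toAlternatingMap.curryLeft v with
    cont := by
      have h : Continuous fun w : Fin k → V => β (Matrix.vecCons v w) :=
        β.cont.comp (continuous_const.matrixVecCons continuous_id)
      exact h }

theorem insertVector_apply {V : Type*} [AddCommGroup V] [Module ℝ V] [TopologicalSpace V]
    {k : ℕ} (v : V) (β : V [⋀^Fin (k + 1)]→L[ℝ] ℝ) (w : Fin k → V) :
    insertVector v β w = β (Matrix.vecCons v w) := rfl

/-- The operator `i_v` on inhomogeneous forms, linear in the vector `v`. -/
def vectorInsertion (V : Type*) [AddCommGroup V] [Module ℝ V] [TopologicalSpace V] :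
    V →ₗ[ℝ] Module.End ℝ (ExtForm V) where
  toFun v :=
    { toFun := fun β k => insertVector v (β (k + 1))
      map_add' := fun _ _ => rfl
      map_smul' := fun _ _ => rfl }
  map_add' v v' := by
    ext β k w
    exact (β (k + 1)).toMultilinearMap.cons_add w v v'
  map_smul' c v := by
    ext β k w
    exact (β (k + 1)).toMultilinearMap.cons_smul w c v

theorem vectorInsertion_sq (V : Type*) [AddCommGroup V] [Module ℝ V] [TopologicalSpace V]
    (v : V) : vectorInsertion V v * vectorInsertion V v = 0 := by
  ext β k w
  exact (β (k + 2)).map_eq_zero_of_eq _ (i := 0) (j := 1) rfl (by simp)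

/-- The insertion `Q ↦ i_Q` of multivectors, the algebra homomorphism from the exterior algebra
of `V` to operators on forms that extends `v ↦ i_v`; so `i_{P ∧ Q} = i_P ∘ i_Q`,
and `i_f` is multiplication by `f` for a scalar `f`. -/
def insertion (V : Type*) [AddCommGroup V] [Module ℝ V] [TopologicalSpace V] :
    ExteriorAlgebra ℝ V →ₐ[ℝ] Module.End ℝ (ExtForm V) :=
  ExteriorAlgebra.lift ℝ ⟨vectorInsertion V, vectorInsertion_sq V⟩

end Insertion

/-! ### Multivector fields and differential forms on a manifold

`M` is a manifold modelled on `ℝⁿ`. Sections are plain dependent functions, and smoothness is a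
predicate. -/

section Fields

variable {n : ℕ} {M : Type*} [TopologicalSpace M] [ChartedSpace (EuclideanSpace ℝ (Fin n)) M]

variable (n M) in
/-- Sections of the bundle of exterior algebras of the tangent spaces. Its ring structure is the
pointwise wedge product. -/
abbrev MultiVec : Type _ := ∀ x : M, ExteriorAlgebra ℝ (TangentSpace (𝓡 n) x)

variable (n M) in
/-- Sections of the bundle of (inhomogeneous) exterior forms on the tangent spaces. -/
abbrev FormField : Type _ := ∀ x : M, ExtForm (TangentSpace (𝓡 n) x)

/-- A vector field as a multivector field of degree one. -/
def ofVectorField (X : ∀ x : M, TangentSpace (𝓡 n) x) : MultiVec n M :=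
  fun x => ExteriorAlgebra.ι ℝ (X x)

/-- A function as a multivector field of degree zero. -/
def ofFunction (f : M → ℝ) : MultiVec n M :=
  fun x => algebraMap ℝ (ExteriorAlgebra ℝ (TangentSpace (𝓡 n) x)) (f x)

/-- The expression of a multivector field in the chart at `x₀`. -/
def MultiVec.inChart (Q : MultiVec n M) (x₀ : M) (y : EuclideanSpace ℝ (Fin n)) :
    ExteriorAlgebra ℝ (EuclideanSpace ℝ (Fin n)) :=
  ExteriorAlgebra.map
    (mfderiv (𝓡 n) 𝓘(ℝ, EuclideanSpace ℝ (Fin n)) (extChartAt (𝓡 n) x₀)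
      ((extChartAt (𝓡 n) x₀).symm y)).toLinearMap
    (Q ((extChartAt (𝓡 n) x₀).symm y))

/-- `Q ∈ D_k(M)`: the section `Q` is homogeneous of degree `k`, and it is smooth, that is, all
coefficients of its chart expressions (images under linear functionals) are smooth. -/
def IsMultiVectorField (k : ℕ) (Q : MultiVec n M) : Prop :=
  (∀ x, Q x ∈ ⋀[ℝ]^k (TangentSpace (𝓡 n) x)) ∧
  ∀ (x₀ : M) (ℓ : Module.Dual ℝ (ExteriorAlgebra ℝ (EuclideanSpace ℝ (Fin n)))),
    ContDiffOn ℝ ∞ (fun y => ℓ (Q.inChart x₀ y)) (extChartAt (𝓡 n) x₀).target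

/-- The degree `k` component of `β` in the chart at `x₀`: its pullback by the inverse chart. -/
def FormField.inChart (β : FormField n M) (x₀ : M) (k : ℕ) (y : EuclideanSpace ℝ (Fin n)) :
    EuclideanSpace ℝ (Fin n) [⋀^Fin k]→L[ℝ] ℝ :=
  (β ((extChartAt (𝓡 n) x₀).symm y) k).compContinuousLinearMap
    (mfderiv 𝓘(ℝ, EuclideanSpace ℝ (Fin n)) (𝓡 n) (extChartAt (𝓡 n) x₀).symm y)

/-- `β` is a smooth differential form: all its chart expressions are smooth. -/
def IsSmoothForm (β : FormField n M) : Prop :=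
  ∀ (x₀ : M) (k : ℕ), ContDiffOn ℝ ∞ (β.inChart x₀ k) (extChartAt (𝓡 n) x₀).target

/-- `Ω` is a volume form: a smooth form of degree `n = dim M` without zeros. -/
def IsVolumeForm (Ω : FormField n M) : Prop :=
  IsSmoothForm Ω ∧ (∀ x k, k ≠ n → Ω x k = 0) ∧ ∀ x, Ω x n ≠ 0

/-- The exterior derivative; at `x` it is computed in the chart at `x`. -/
def d (β : FormField n M) : FormField n M := fun x k =>
  match k with
  | 0 => 0
  | k + 1 =>
    (extDeriv (β.inChart x k) (extChartAt (𝓡 n) x x)).compContinuousLinearMap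
      (mfderiv (𝓡 n) 𝓘(ℝ, EuclideanSpace ℝ (Fin n)) (extChartAt (𝓡 n) x) x)

/-- The insertion `i_Q β = Q ⌋ β`, pointwise. -/
def ins (Q : MultiVec n M) (β : FormField n M) : FormField n M :=
  fun x => insertion (TangentSpace (𝓡 n) x) (Q x) (β x)

/-- The Lie derivative along a multivector field of degree `k`: the graded commutator
`L_Q = [i_Q, d] = i_Q ∘ d - (-1)^k d ∘ i_Q`. -/
def lieDer (k : ℕ) (Q : MultiVec n M) (β : FormField n M) : FormField n M :=
  ins Q (d β) - (-1 : ℝ) ^ k • d (ins Q β)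

/-- `R = ⟦P, Q⟧` for multivector fields `P`, `Q` of degrees `k`, `l`: the Schouten bracket is the
multivector field with `i_R = [[i_P, d], i_Q] = [L_P, i_Q]` (graded commutators of operators on
differential forms; `L_P` has degree `1 - k` and `i_Q` has degree `-l`). As `R ↦ i_R` is injective,
this determines `R`. -/
def IsSchouten (k l : ℕ) (P Q R : MultiVec n M) : Prop :=
  ∀ β : FormField n M, IsSmoothForm β →
    ins R β = lieDer k P (ins Q β) - (-1 : ℝ) ^ ((k + 1) * l) • ins Q (lieDer k P β)

/-- `P` is a Poisson bivector: a smooth bivector field with `⟦P, P⟧ = 0`. -/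
def IsPoisson (P : MultiVec n M) : Prop :=
  IsMultiVectorField 2 P ∧ IsSchouten 2 2 P P 0

/-- Poisson structures are compatible if their sum is a Poisson structure. -/
def IsCompatible (P₁ P₂ : MultiVec n M) : Prop :=
  IsPoisson P₁ ∧ IsPoisson P₂ ∧ IsPoisson (P₁ + P₂)

/-- The Hamiltonian vector field `P_f = ⟦P, f⟧ = -df ⌋ P` of a function `f`, as a multivector field
of degree one. The contraction is the antiderivation with `df ⌋ X = X(f)`, so that
`df ⌋ (X ∧ Y) = X(f) Y - Y(f) X`. -/
def hamiltonian (P : MultiVec n M) (f : M → ℝ) : MultiVec n M := fun x =>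
  -CliffordAlgebra.contractLeft (mvfderiv (𝓡 n) f x).toLinearMap (P x)

/-- `f` is a Casimir function of `P`: its Hamiltonian vector field vanishes. -/
def IsCasimir (P : MultiVec n M) (f : M → ℝ) : Prop :=
  hamiltonian P f = 0

/-- `Ξ` is the `Ω`-modular vector field of `P`: `Ξ ⌋ Ω = d(P ⌋ Ω)`. -/
def IsModularVectorField (Ω : FormField n M) (P : MultiVec n M)
    (Ξ : ∀ x : M, TangentSpace (𝓡 n) x) : Prop :=
  IsMultiVectorField 1 (ofVectorField Ξ) ∧ ins (ofVectorField Ξ) Ω = d (ins P Ω)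

/-- A Poisson structure `P` is `Ω`-unimodular if `L_P Ω = 0`. -/
def IsUnimodular (Ω : FormField n M) (P : MultiVec n M) : Prop :=
  IsPoisson P ∧ lieDer 2 P Ω = 0

end Fields

end ModularPoisson

end

/-!
Write `i_Q` for insertion, `L_Q = [i_Q, d]` for the Lie derivative, `H = P_ν` for the Hamiltonian
vector field, and read every Schouten bracket as a graded commutator of operators on smooth forms.
Apart from one point, the proof is a computation in the ring of these operators, from `d² = 0`,
the Leibniz rule in the forms `[L_P, ν] = i_H` and `[L_Ξ, ν] = Ξ(ν) = 1`, and the commutation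
rules of insertions:

* `⟦P, P⟧ = 0` gives `L_P² = 0`, hence `⟦P, H⟧ = 0` (`lie_anticomm_hamiltonian`);
* `⟦P, Ξ⟧ = 0` gives `[L_Ξ, L_P] = 0`, and together with `[L_Ξ, ν] = 1` this gives `⟦Ξ, H⟧ = 0`
  (`lie_comm_hamiltonian`).

So all brackets among `P`, `Ξ` and `H` vanish, therefore also those among `P` and `Ξ ∧ H`, which
makes `Ξ ∧ H`, `P + Ξ ∧ H` and `2P + Ξ ∧ H` Poisson, and `⟦P, νΞ⟧ = ⟦P, ν⟧ ∧ Ξ = H ∧ Ξ`. On the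
volume form, `L_P Ω = -Ξ ⌋ Ω`, `L_Ξ Ω = 0` and `L_H Ω = Ω`, so that `L_{Ξ ∧ H} Ω = Ξ ⌋ Ω`.

The point that is not formal is `⟦P, Ξ⟧ = 0`. The operator `[L_P, i_Ξ]` annihilates the volume form,
because it maps it to `-L_P² Ω - i_Ξ² Ω`. It vanishes on all forms because it is tensorial: writing
`d = ∑ᵢ eⁱ ∧ ∂ᵢ` in a chart, all derivatives of the form cancel and the insertion of a bivector
remains (`exists_schouten`), and a bivector annihilating a nonzero form of top degree is zero
(`eq_zero_of_insertion_eq_zero`).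

The operators `d` and `i_Q` preserve smooth forms. For `d`, which at each point is computed in the
preferred chart at that point, this needs that the formula is the same in all charts (`localRep_d`).
-/

noncomputable section

namespace ModularPoisson

/-! ### Bivectors -/

section Bivectors

variable {V : Type*} [AddCommGroup V] [Module ℝ V]

theorem mem_exteriorPower_two_induction {p : ExteriorAlgebra ℝ V → Prop}
    (hmul : ∀ v w, p (ExteriorAlgebra.ι ℝ v * ExteriorAlgebra.ι ℝ w))
    (hadd : ∀ a b, p a → p b → p (a + b))
    {Q : ExteriorAlgebra ℝ V} (hQ : Q ∈ ⋀[ℝ]^2 V) : p Q := by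
  rw [ExteriorAlgebra.exteriorPower, pow_two] at hQ
  refine Submodule.mul_induction_on hQ ?_ hadd
  rintro _ ⟨v, rfl⟩ _ ⟨w, rfl⟩
  exact hmul v w

theorem mem_exteriorPower_one {Q : ExteriorAlgebra ℝ V} :
    Q ∈ ⋀[ℝ]^1 V ↔ ∃ v, ExteriorAlgebra.ι ℝ v = Q := by
  rw [ExteriorAlgebra.exteriorPower, pow_one]
  rfl

theorem ι_mem_exteriorPower_one (v : V) : ExteriorAlgebra.ι ℝ v ∈ ⋀[ℝ]^1 V :=
  mem_exteriorPower_one.2 ⟨v, rfl⟩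

theorem exterior_contractLeft_ι (α : Module.Dual ℝ V) (v : V) :
    CliffordAlgebra.contractLeft α (ExteriorAlgebra.ι ℝ v) =
      algebraMap ℝ (ExteriorAlgebra ℝ V) (α v) :=
  CliffordAlgebra.contractLeft_ι _ _ _

theorem exterior_contractLeft_ι_mul (α : Module.Dual ℝ V) (v : V) (Q : ExteriorAlgebra ℝ V) :
    CliffordAlgebra.contractLeft α (ExteriorAlgebra.ι ℝ v * Q) =
      (α v • Q - ExteriorAlgebra.ι ℝ v * CliffordAlgebra.contractLeft α Q : ExteriorAlgebra ℝ V) :=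
  CliffordAlgebra.contractLeft_ι_mul _ _ _

theorem contractLeft_ι_mul_ι (α : Module.Dual ℝ V) (v w : V) :
    CliffordAlgebra.contractLeft α (ExteriorAlgebra.ι ℝ v * ExteriorAlgebra.ι ℝ w) =
      ExteriorAlgebra.ι ℝ (α v • w - α w • v) := by
  rw [exterior_contractLeft_ι_mul, exterior_contractLeft_ι, map_sub, map_smul,
    map_smul, ← Algebra.commutes, ← Algebra.smul_def]

theorem contractLeft_mem_exteriorPower_one (α : Module.Dual ℝ V) {Q : ExteriorAlgebra ℝ V}
    (hQ : Q ∈ ⋀[ℝ]^2 V) :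
    (CliffordAlgebra.contractLeft α Q : ExteriorAlgebra ℝ V) ∈ ⋀[ℝ]^1 V := by
  refine mem_exteriorPower_two_induction (p := fun Q =>
    (CliffordAlgebra.contractLeft α Q : ExteriorAlgebra ℝ V) ∈ ⋀[ℝ]^1 V) ?_ ?_ hQ
  · intro v w
    rw [contractLeft_ι_mul_ι]
    exact ι_mem_exteriorPower_one _
  · intro a b ha hb
    rw [map_add]
    exact add_mem ha hb

/-- Euler's identity for bivectors: `∑ᵢ eᵢ ∧ (eⁱ ⌋ Q) = 2 Q`. -/
theorem sum_ι_mul_contractLeft {ι : Type*} [Fintype ι] (b : Module.Basis ι ℝ V)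
    {Q : ExteriorAlgebra ℝ V} (hQ : Q ∈ ⋀[ℝ]^2 V) :
    ∑ i, ExteriorAlgebra.ι ℝ (b i) * CliffordAlgebra.contractLeft (b.coord i) Q =
      (2 : ℝ) • Q := by
  refine mem_exteriorPower_two_induction (p := fun Q =>
    ∑ i, ExteriorAlgebra.ι ℝ (b i) * CliffordAlgebra.contractLeft (b.coord i) Q =
      (2 : ℝ) • Q) ?_ ?_ hQ
  · intro v w
    have key : ∀ u z : V, ∑ i, ExteriorAlgebra.ι ℝ (b i) *
        ExteriorAlgebra.ι ℝ (b.coord i u • z) = ExteriorAlgebra.ι ℝ u * ExteriorAlgebra.ι ℝ z := by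
      intro u z
      simp only [map_smul, mul_smul_comm, ← smul_mul_assoc]
      rw [← Finset.sum_mul]
      simp only [← map_smul, ← map_sum, Module.Basis.coord_apply, b.sum_repr]
    simp only [contractLeft_ι_mul_ι, map_sub, mul_sub, Finset.sum_sub_distrib]
    rw [key, key, two_smul, sub_eq_add_neg, add_right_inj, neg_eq_iff_add_eq_zero, add_comm]
    exact ExteriorAlgebra.ι_add_mul_swap v w
  · intro a b' ha hb
    simp only [map_add, mul_add, Finset.sum_add_distrib, ha, hb, smul_add]

/-- Contraction is natural: if `α'` is the pullback of the covector `α` by `A`, then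
`α ⌋ A_* Q = A_* (α' ⌋ Q)`. -/
theorem contractLeft_map {W : Type*} [AddCommGroup W] [Module ℝ W] (A : V →ₗ[ℝ] W)
    {α : Module.Dual ℝ W} {α' : Module.Dual ℝ V} (h : ∀ v, α (A v) = α' v) (Q : ExteriorAlgebra ℝ V) :
    CliffordAlgebra.contractLeft α (ExteriorAlgebra.map A Q) =
      ExteriorAlgebra.map A (CliffordAlgebra.contractLeft α' Q) := by
  induction Q using CliffordAlgebra.left_induction with
  | algebraMap r =>
    rw [CliffordAlgebra.contractLeft_algebraMap, map_zero]
    erw [AlgHom.commutes]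
    exact CliffordAlgebra.contractLeft_algebraMap _ _ _
  | add x y hx hy => simp only [map_add, hx, hy]
  | ι_mul x v hx =>
    change CliffordAlgebra.contractLeft α (ExteriorAlgebra.map A (ExteriorAlgebra.ι ℝ v * x)) =
      ExteriorAlgebra.map A (CliffordAlgebra.contractLeft α' (ExteriorAlgebra.ι ℝ v * x))
    rw [map_mul, ExteriorAlgebra.map_apply_ι, exterior_contractLeft_ι_mul,
      exterior_contractLeft_ι_mul, hx, map_sub, map_smul, map_mul, ExteriorAlgebra.map_apply_ι, h]

theorem map_mem_exteriorPower {W : Type*} [AddCommGroup W] [Module ℝ W] (A : V →ₗ[ℝ] W) (k : ℕ)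
    {Q : ExteriorAlgebra ℝ V} (hQ : Q ∈ ⋀[ℝ]^k V) : ExteriorAlgebra.map A Q ∈ ⋀[ℝ]^k W := by
  have h : (⋀[ℝ]^k V).map (ExteriorAlgebra.map A).toLinearMap ≤ ⋀[ℝ]^k W := by
    rw [ExteriorAlgebra.exteriorPower, ExteriorAlgebra.exteriorPower, Submodule.map_pow]
    refine pow_le_pow_left' ?_ k
    rintro _ ⟨_, ⟨v, rfl⟩, rfl⟩
    exact ⟨A v, (ExteriorAlgebra.map_apply_ι A v).symm⟩
  exact h ⟨Q, hQ, rfl⟩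

end Bivectors

/-! ### Insertions into alternating forms -/

section LinearAlgebra

variable {V : Type*} [AddCommGroup V] [Module ℝ V] [TopologicalSpace V]

theorem insertion_ι (v : V) : insertion V (ExteriorAlgebra.ι ℝ v) = vectorInsertion V v :=
  ExteriorAlgebra.lift_ι_apply ℝ _ _ _

theorem vectorInsertion_apply (v : V) (β : ExtForm V) (k : ℕ) :
    vectorInsertion V v β k = insertVector v (β (k + 1)) := rfl

theorem vectorInsertion_self (v : V) (β : ExtForm V) :
    vectorInsertion V v (vectorInsertion V v β) = 0 :=
  LinearMap.congr_fun (vectorInsertion_sq V v) β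

theorem vectorInsertion_anticomm (v w : V) (β : ExtForm V) :
    vectorInsertion V v (vectorInsertion V w β) = -vectorInsertion V w (vectorInsertion V v β) := by
  have h := vectorInsertion_self (v + w) β
  simp only [map_add, LinearMap.add_apply, vectorInsertion_self, zero_add, add_zero] at h
  exact eq_neg_of_add_eq_zero_right h

/-- The exterior product `α ∧ β` of a covector with a `k`-form. -/
def wedgeCovector {k : ℕ} (α : V →L[ℝ] ℝ) (β : V [⋀^Fin k]→L[ℝ] ℝ) :
    V [⋀^Fin (k + 1)]→L[ℝ] ℝ :=
  { AlternatingMap.alternatizeUncurryFin (α.toLinearMap.smulRight β.toAlternatingMap) with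
    cont := by
      have h : Continuous fun v : Fin (k + 1) → V =>
          ∑ i : Fin (k + 1), (-1 : ℤ) ^ i.val • (α (v i) * β (i.removeNth v)) := by
        refine continuous_finsetSum _ fun i _ => (Continuous.mul ?_ ?_).const_smul ((-1 : ℤ) ^ i.val)
        · exact α.continuous.comp (continuous_apply i)
        · exact β.cont.comp (continuous_pi fun j => continuous_apply _)
      convert h using 2 with v
      exact AlternatingMap.alternatizeUncurryFin_apply _ _ }

theorem wedgeCovector_apply {k : ℕ} (α : V →L[ℝ] ℝ) (β : V [⋀^Fin k]→L[ℝ] ℝ)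
    (v : Fin (k + 1) → V) :
    wedgeCovector α β v =
      ∑ i : Fin (k + 1), (-1 : ℤ) ^ i.val • (α (v i) * β (i.removeNth v)) :=
  AlternatingMap.alternatizeUncurryFin_apply _ _

/-- The operator `α ∧ ·` on inhomogeneous forms. -/
def covectorWedge (α : V →L[ℝ] ℝ) : Module.End ℝ (ExtForm V) where
  toFun β k :=
    match k with
    | 0 => 0
    | k + 1 => wedgeCovector α (β k)
  map_add' β γ := by
    funext k
    cases k with
    | zero => simp
    | succ k =>
      ext v
      simp [wedgeCovector_apply, mul_add, Finset.sum_add_distrib]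
  map_smul' c β := by
    funext k
    cases k with
    | zero => simp
    | succ k =>
      ext v
      simp only [wedgeCovector_apply, Pi.smul_apply, ContinuousAlternatingMap.smul_apply,
        RingHom.id_apply, smul_eq_mul, Finset.mul_sum]
      refine Finset.sum_congr rfl fun i _ => ?_
      simp only [zsmul_eq_mul]
      ring

theorem covectorWedge_apply_zero (α : V →L[ℝ] ℝ) (β : ExtForm V) :
    covectorWedge α β 0 = 0 := rfl

theorem covectorWedge_apply_succ (α : V →L[ℝ] ℝ) (β : ExtForm V) (k : ℕ) :
    covectorWedge α β (k + 1) = wedgeCovector α (β k) := rfl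

/-- Insertion of a vector is an antiderivation: `i_v (α ∧ β) = α(v) β - α ∧ i_v β`. -/
theorem vectorInsertion_covectorWedge (v : V) (α : V →L[ℝ] ℝ) (β : ExtForm V) :
    vectorInsertion V v (covectorWedge α β) =
      α v • β - covectorWedge α (vectorInsertion V v β) := by
  rw [eq_sub_iff_add_eq]
  ext k w
  change insertVector v (wedgeCovector α (β k)) w + covectorWedge α (vectorInsertion V v β) k w =
    α v * β k w
  rw [insertVector_apply, wedgeCovector_apply, Fin.sum_univ_succ]
  have h0 : (-1 : ℤ) ^ (0 : Fin (k + 1)).val • (α ((Matrix.vecCons v w) 0) *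
      β k (Fin.removeNth 0 (Matrix.vecCons v w))) = α v * β k w := by
    simp [Matrix.vecCons]
  rw [h0, add_assoc, add_eq_left]
  cases k with
  | zero => simp [covectorWedge_apply_zero]
  | succ k =>
    rw [covectorWedge_apply_succ, wedgeCovector_apply, ← Finset.sum_add_distrib]
    refine Finset.sum_eq_zero fun i _ => ?_
    have h1 : Fin.removeNth i.succ (Matrix.vecCons v w) =
        Matrix.vecCons v (Fin.removeNth i w) := by
      funext j
      refine Fin.cases ?_ (fun j => ?_) j <;> simp [Fin.removeNth]
    rw [h1, vectorInsertion_apply, insertVector_apply]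
    simp [pow_succ]

/-- The commutator of the insertion of a bivector with `α ∧ ·` is the insertion of the vector
`-α ⌋ Q`, that is, `i_Q (α ∧ β) = α ∧ i_Q β - i_{α ⌋ Q} β`. -/
theorem insertion_covectorWedge (α : V →L[ℝ] ℝ) {Q : ExteriorAlgebra ℝ V}
    (hQ : Q ∈ ⋀[ℝ]^2 V) (β : ExtForm V) :
    insertion V Q (covectorWedge α β) = covectorWedge α (insertion V Q β) -
      insertion V (CliffordAlgebra.contractLeft α.toLinearMap Q) β := by
  refine mem_exteriorPower_two_induction (p := fun Q =>
    insertion V Q (covectorWedge α β) = covectorWedge α (insertion V Q β) -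
      insertion V (CliffordAlgebra.contractLeft α.toLinearMap Q) β) ?_ ?_ hQ
  · intro v w
    rw [contractLeft_ι_mul_ι, map_sub, map_smul, map_smul, map_mul, map_sub, map_smul, map_smul,
      insertion_ι, insertion_ι, Module.End.mul_apply, Module.End.mul_apply,
      vectorInsertion_covectorWedge, map_sub, vectorInsertion_covectorWedge, map_smul]
    simp only [LinearMap.sub_apply, LinearMap.smul_apply, ContinuousLinearMap.coe_coe]
    abel
  · intro a b ha hb
    simp only [map_add, LinearMap.add_apply, ha, hb]
    abel

theorem insertion_vectorInsertion_comm (v : V) {Q : ExteriorAlgebra ℝ V} (hQ : Q ∈ ⋀[ℝ]^2 V)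
    (β : ExtForm V) :
    insertion V Q (vectorInsertion V v β) = vectorInsertion V v (insertion V Q β) := by
  refine mem_exteriorPower_two_induction (p := fun Q =>
    insertion V Q (vectorInsertion V v β) = vectorInsertion V v (insertion V Q β)) ?_ ?_ hQ
  · intro a b
    rw [map_mul, insertion_ι, insertion_ι, Module.End.mul_apply, Module.End.mul_apply,
      vectorInsertion_anticomm b v, map_neg, vectorInsertion_anticomm a v, neg_neg]
  · intro a b ha hb
    simp only [map_add, LinearMap.add_apply, ha, hb]

/-- A nonzero form `Ω` with `α ∧ Ω = 0` for all covectors `α` (a form of top degree) is not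
annihilated by any nonzero vector. -/
theorem eq_zero_of_vectorInsertion_eq_zero {Ω : ExtForm V} (hΩ : Ω ≠ 0)
    (htop : ∀ α : V →L[ℝ] ℝ, covectorWedge α Ω = 0) {v : V} (hv : vectorInsertion V v Ω = 0)
    (α : V →L[ℝ] ℝ) : α v = 0 := by
  have h := vectorInsertion_covectorWedge v α Ω
  rw [htop, hv, map_zero, map_zero, sub_zero] at h
  exact (smul_eq_zero.1 h.symm).resolve_right hΩ

/-- A bivector annihilating a nonzero form of top degree vanishes: its contractions `α ⌋ Q` are
vectors with the same property, so they vanish, and Euler's identity recovers `Q` from them. -/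
theorem eq_zero_of_insertion_eq_zero {ι : Type*} [Fintype ι] (b : Module.Basis ι ℝ V)
    (hb : ∀ i, Continuous (b.coord i)) {Ω : ExtForm V} (hΩ : Ω ≠ 0)
    (htop : ∀ α : V →L[ℝ] ℝ, covectorWedge α Ω = 0) {Q : ExteriorAlgebra ℝ V}
    (hQ : Q ∈ ⋀[ℝ]^2 V) (h : insertion V Q Ω = 0) : Q = 0 := by
  have h2 := sum_ι_mul_contractLeft b hQ
  rw [Finset.sum_eq_zero] at h2
  · exact (smul_eq_zero.1 h2.symm).resolve_left two_ne_zero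
  intro i _
  obtain ⟨v, hv⟩ := mem_exteriorPower_one.1 (contractLeft_mem_exteriorPower_one (b.coord i) hQ)
  have h3 := insertion_covectorWedge ⟨b.coord i, hb i⟩ hQ Ω
  rw [htop, h, map_zero, map_zero, zero_sub, zero_eq_neg] at h3
  change insertion V (CliffordAlgebra.contractLeft (b.coord i) Q) Ω = 0 at h3
  rw [← hv, insertion_ι] at h3
  have hv0 : v = 0 := b.ext_elem fun j => by
    have := eq_zero_of_vectorInsertion_eq_zero hΩ htop h3 ⟨b.coord j, hb j⟩
    simpa using this
  rw [← hv, hv0, map_zero, mul_zero]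

/-! ### Pullback of forms by linear maps -/

/-- The pullback of inhomogeneous forms by a continuous linear map. -/
def pullback {W : Type*} [AddCommGroup W] [Module ℝ W] [TopologicalSpace W] (B : W →L[ℝ] V) :
    ExtForm V →ₗ[ℝ] ExtForm W where
  toFun β k := (β k).compContinuousLinearMap B
  map_add' _ _ := rfl
  map_smul' _ _ := rfl

section Pullback

variable {W : Type*} [AddCommGroup W] [Module ℝ W] [TopologicalSpace W]

theorem pullback_apply (B : W →L[ℝ] V) (β : ExtForm V) (k : ℕ) :
    pullback B β k = (β k).compContinuousLinearMap B := rfl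

theorem pullback_injective {B : W →L[ℝ] V} {A : V →L[ℝ] W} (h : ∀ v, B (A v) = v) :
    Function.Injective (pullback B) := by
  intro β γ hβγ
  funext k
  ext w
  have h1 := DFunLike.congr_fun (congrFun hβγ k) (fun i => A (w i))
  simpa [pullback_apply, Function.comp_def, h] using h1

/-- Insertion is natural: the push-forward of `Q` by `A`, inserted into the pullback of `β` by a left
inverse `B` of `A`, is the pullback of `i_Q β`. -/
theorem insertion_map_pullback {B : W →L[ℝ] V} {A : V →ₗ[ℝ] W} (h : ∀ v, B (A v) = v)
    (Q : ExteriorAlgebra ℝ V) (β : ExtForm V) :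
    insertion W (ExteriorAlgebra.map A Q) (pullback B β) = pullback B (insertion V Q β) := by
  induction Q using ExteriorAlgebra.induction generalizing β with
  | algebraMap r =>
    rw [AlgHom.commutes, AlgHom.commutes, AlgHom.commutes, Module.algebraMap_end_apply,
      Module.algebraMap_end_apply, map_smul]
  | ι v =>
    rw [ExteriorAlgebra.map_apply_ι, insertion_ι, insertion_ι]
    funext k
    ext w
    simp only [vectorInsertion_apply, insertVector_apply, pullback_apply,
      ContinuousAlternatingMap.compContinuousLinearMap_apply]
    congr 1
    funext i
    refine Fin.cases ?_ (fun i => ?_) i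
    · exact h v
    · rfl
  | mul a b ha hb =>
    rw [map_mul, map_mul, map_mul, Module.End.mul_apply, Module.End.mul_apply, hb, ha]
  | add a b ha hb =>
    simp only [map_add, LinearMap.add_apply, ha, hb]

end Pullback

end LinearAlgebra

/-! ### Calculus of multivector fields and forms on a normed space -/

section Calculus

variable {E : Type*} [NormedAddCommGroup E] [NormedSpace ℝ E]

/-- A function with values in a vector space without topology is smooth on `U` if its images under
all linear functionals are. -/
def WeaklySmoothOn {A : Type*} [AddCommGroup A] [Module ℝ A] (f : E → A) (U : Set E) : Prop :=
  ∀ ℓ : Module.Dual ℝ A, ContDiffOn ℝ ∞ (fun y => ℓ (f y)) U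

section WeaklySmooth

variable {A B C : Type*} [AddCommGroup A] [Module ℝ A] [AddCommGroup B] [Module ℝ B]
  [AddCommGroup C] [Module ℝ C]

theorem WeaklySmoothOn.add {f g : E → A} {U : Set E} (hf : WeaklySmoothOn f U)
    (hg : WeaklySmoothOn g U) : WeaklySmoothOn (fun y => f y + g y) U := fun ℓ => by
  simpa using (hf ℓ).add (hg ℓ)

theorem WeaklySmoothOn.congr {f g : E → A} {U : Set E} (hf : WeaklySmoothOn f U)
    (h : ∀ y ∈ U, g y = f y) : WeaklySmoothOn g U := fun ℓ =>
  (hf ℓ).congr fun y hy => by rw [h y hy]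

theorem WeaklySmoothOn.bilinear [FiniteDimensional ℝ A] [FiniteDimensional ℝ B]
    (m : A →ₗ[ℝ] B →ₗ[ℝ] C) {f : E → A} {g : E → B} {U : Set E} (hf : WeaklySmoothOn f U)
    (hg : WeaklySmoothOn g U) : WeaklySmoothOn (fun y => m (f y) (g y)) U := fun ℓ => by
  let a := Module.finBasis ℝ A
  let b := Module.finBasis ℝ B
  have h : ∀ y, ℓ (m (f y) (g y)) =
      ∑ i, ∑ j, a.coord i (f y) * (b.coord j (g y) * ℓ (m (a i) (b j))) := by
    intro y
    conv_lhs => rw [← a.sum_repr (f y), ← b.sum_repr (g y)]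
    simp only [map_sum, LinearMap.sum_apply, map_smul, LinearMap.smul_apply, smul_eq_mul,
      Module.Basis.coord_apply, Finset.mul_sum]
    rw [Finset.sum_comm]
    exact Finset.sum_congr rfl fun i _ => Finset.sum_congr rfl fun j _ => mul_left_comm _ _ _
  simp only [h]
  exact ContDiffOn.sum fun i _ => ContDiffOn.sum fun j _ =>
    (hf (a.coord i)).mul ((hg (b.coord j)).mul contDiffOn_const)

end WeaklySmooth

/-- The directional derivative of a function with values in a finite-dimensional vector space
without topology, computed coefficientwise. -/
def weakDeriv {A : Type*} [AddCommGroup A] [Module ℝ A] [FiniteDimensional ℝ A] (f : E → A)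
    (y v : E) : A :=
  ∑ i, fderiv ℝ (fun z => (Module.finBasis ℝ A).coord i (f z)) y v • Module.finBasis ℝ A i

/-- The derivative commutes with all linear functionals; in particular it does not depend on the
basis in its definition. -/
theorem apply_weakDeriv {A : Type*} [AddCommGroup A] [Module ℝ A] [FiniteDimensional ℝ A]
    {f : E → A} {y : E} (hf : ∀ ℓ : Module.Dual ℝ A, DifferentiableAt ℝ (fun z => ℓ (f z)) y)
    (v : E) (ℓ : Module.Dual ℝ A) :
    ℓ (weakDeriv f y v) = fderiv ℝ (fun z => ℓ (f z)) y v := by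
  let a := Module.finBasis ℝ A
  have h : (fun z => ℓ (f z)) = fun z => ∑ i, a.coord i (f z) * ℓ (a i) := by
    funext z
    conv_lhs => rw [← a.sum_repr (f z)]
    simp only [map_sum, map_smul, smul_eq_mul, Module.Basis.coord_apply]
  rw [h, fderiv_fun_sum fun i _ => (hf (a.coord i)).mul_const _]
  simp only [weakDeriv, map_sum, map_smul, smul_eq_mul, sum_apply]
  refine Finset.sum_congr rfl fun i _ => ?_
  rw [fderiv_mul_const (hf (a.coord i))]
  simp [mul_comm, a]

/-- The derivative of a function with values in a subspace has values in that subspace. -/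
theorem weakDeriv_mem {A : Type*} [AddCommGroup A] [Module ℝ A] [FiniteDimensional ℝ A]
    {f : E → A} {y : E} (hf : ∀ ℓ : Module.Dual ℝ A, DifferentiableAt ℝ (fun z => ℓ (f z)) y)
    (S : Submodule ℝ A) (hS : ∀ z, f z ∈ S) (v : E) : weakDeriv f y v ∈ S := by
  by_contra h
  obtain ⟨ℓ, hℓ, hS'⟩ := Submodule.exists_le_ker_of_notMem h
  apply hℓ
  rw [apply_weakDeriv hf]
  have h0 : (fun z => ℓ (f z)) = fun _ => 0 := funext fun z => hS' (hS z)
  simp [h0]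

/-- `insertVector v` as a continuous linear map. -/
def insertVectorCLM (v : E) (k : ℕ) :
    (E [⋀^Fin (k + 1)]→L[ℝ] ℝ) →L[ℝ] (E [⋀^Fin k]→L[ℝ] ℝ) :=
  (ContinuousLinearMap.apply ℝ _ v).comp
    (ContinuousAlternatingMap.curryLeftLI (𝕜 := ℝ) (E := E) (F := ℝ)
      (n := k)).toContinuousLinearMap

theorem contDiffOn_insertion_const (a : ExteriorAlgebra ℝ E) {B : E → ExtForm E} {U : Set E}
    (hB : ∀ k, ContDiffOn ℝ ∞ (fun y => B y k) U) (k : ℕ) :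
    ContDiffOn ℝ ∞ (fun y => insertion E a (B y) k) U := by
  induction a using ExteriorAlgebra.induction generalizing B k with
  | algebraMap r =>
    simp only [AlgHom.commutes, Module.algebraMap_end_apply, Pi.smul_apply]
    exact (hB k).const_smul r
  | ι v =>
    simp only [insertion_ι, vectorInsertion_apply]
    exact (insertVectorCLM v k).contDiff.comp_contDiffOn (hB (k + 1))
  | mul a b ha hb =>
    simp only [map_mul, Module.End.mul_apply]
    exact ha (fun k => hb hB k) k
  | add a b ha hb =>
    simp only [map_add, LinearMap.add_apply, Pi.add_apply]
    exact (ha hB k).add (hb hB k)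

/-- The directional derivative of a family of inhomogeneous forms, degree by degree. -/
def formDeriv (B : E → ExtForm E) (y v : E) : ExtForm E := fun k => fderiv ℝ (fun z => B z k) y v

/-- The insertion of a constant multivector commutes with differentiation. -/
theorem hasFDerivAt_insertion_const (a : ExteriorAlgebra ℝ E) {B : E → ExtForm E} {y : E}
    {B' : ∀ k, E →L[ℝ] E [⋀^Fin k]→L[ℝ] ℝ}
    (hB : ∀ k, HasFDerivAt (fun z => B z k) (B' k) y) (k : ℕ) :
    ∃ T : E →L[ℝ] E [⋀^Fin k]→L[ℝ] ℝ, HasFDerivAt (fun z => insertion E a (B z) k) T y ∧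
      ∀ v, T v = insertion E a (fun j => B' j v) k := by
  induction a using ExteriorAlgebra.induction generalizing B B' k with
  | algebraMap r =>
    simp only [AlgHom.commutes, Module.algebraMap_end_apply, Pi.smul_apply]
    exact ⟨r • B' k, (hB k).const_smul r, fun _ => rfl⟩
  | ι v =>
    simp only [insertion_ι, vectorInsertion_apply]
    exact ⟨_, (insertVectorCLM v k).hasFDerivAt.comp y (hB (k + 1)), fun _ => rfl⟩
  | mul a b ha hb =>
    simp only [map_mul, Module.End.mul_apply]
    choose T hT hT' using hb hB
    obtain ⟨S, hS, hS'⟩ := ha hT k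
    refine ⟨S, hS, fun v => ?_⟩
    rw [hS']
    simp only [hT']
  | add a b ha hb =>
    simp only [map_add, LinearMap.add_apply, Pi.add_apply]
    obtain ⟨S, hS, hS'⟩ := ha hB k
    obtain ⟨T, hT, hT'⟩ := hb hB k
    exact ⟨S + T, hS.add hT, fun v => by simp [hS', hT']⟩

variable [FiniteDimensional ℝ E]

instance : FiniteDimensional ℝ (ExteriorAlgebra ℝ E) :=
  Module.Finite.of_basis (Module.finBasis ℝ E).ExteriorAlgebra

theorem insertion_eq_sum (Q : ExteriorAlgebra ℝ E) (β : ExtForm E) (k : ℕ) :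
    insertion E Q β k = ∑ i, (Module.finBasis ℝ (ExteriorAlgebra ℝ E)).coord i Q •
      insertion E (Module.finBasis ℝ (ExteriorAlgebra ℝ E) i) β k := by
  conv_lhs => rw [← (Module.finBasis ℝ (ExteriorAlgebra ℝ E)).sum_repr Q]
  simp only [map_sum, map_smul, LinearMap.sum_apply, LinearMap.smul_apply, Finset.sum_apply,
    Pi.smul_apply, Module.Basis.coord_apply]

theorem contDiffOn_insertion {Q : E → ExteriorAlgebra ℝ E} {B : E → ExtForm E} {U : Set E}
    (hQ : WeaklySmoothOn Q U) (hB : ∀ k, ContDiffOn ℝ ∞ (fun y => B y k) U) (k : ℕ) :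
    ContDiffOn ℝ ∞ (fun y => insertion E (Q y) (B y) k) U := by
  simp only [insertion_eq_sum (Q _)]
  exact ContDiffOn.sum fun i _ => (hQ _).smul (contDiffOn_insertion_const _ hB k)

/-- The product rule for the insertion of multivector fields into forms. -/
theorem formDeriv_insertion {Q : E → ExteriorAlgebra ℝ E} {B : E → ExtForm E} {y : E}
    (hQ : ∀ ℓ : Module.Dual ℝ (ExteriorAlgebra ℝ E), DifferentiableAt ℝ (fun z => ℓ (Q z)) y)
    (hB : ∀ k, DifferentiableAt ℝ (fun z => B z k) y) (v : E) :
    formDeriv (fun z => insertion E (Q z) (B z)) y v =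
      insertion E (weakDeriv Q y v) (B y) + insertion E (Q y) (formDeriv B y v) := by
  funext k
  let b := Module.finBasis ℝ (ExteriorAlgebra ℝ E)
  have h1 : ∀ i, ∃ T : E →L[ℝ] E [⋀^Fin k]→L[ℝ] ℝ,
      HasFDerivAt (fun z => insertion E (b i) (B z) k) T y ∧
      ∀ v, T v = insertion E (b i) (formDeriv B y v) k := fun i =>
    hasFDerivAt_insertion_const (b i) (fun k => (hB k).hasFDerivAt) k
  choose T hT hT' using h1
  have h2 : HasFDerivAt (fun z => insertion E (Q z) (B z) k)
      (∑ i, (b.coord i (Q y) • T i +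
        (fderiv ℝ (fun z => b.coord i (Q z)) y).smulRight (insertion E (b i) (B y) k))) y := by
    have h3 := HasFDerivAt.fun_sum (u := Finset.univ) fun i _ =>
      (hQ (b.coord i)).hasFDerivAt.smul (hT i)
    refine h3.congr_of_eventuallyEq (Filter.Eventually.of_forall fun z => ?_)
    exact insertion_eq_sum (Q z) (B z) k
  rw [formDeriv, h2.fderiv, Pi.add_apply, insertion_eq_sum (Q y), insertion_eq_sum (weakDeriv Q y v),
    sum_apply, ← Finset.sum_add_distrib]
  refine Finset.sum_congr rfl fun i _ => ?_
  rw [apply_weakDeriv hQ, add_comm]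
  simp [hT', b]

/-- The exterior derivative of a family of inhomogeneous forms on a normed space. -/
def extD (B : E → ExtForm E) (y : E) : ExtForm E := fun k =>
  match k with
  | 0 => 0
  | k + 1 => extDeriv (fun z => B z k) y

/-- In a basis, `d = ∑ᵢ eⁱ ∧ ∂ᵢ`. -/
theorem extD_eq_sum {ι : Type*} [Fintype ι] (e : Module.Basis ι ℝ E) (B : E → ExtForm E) (y : E) :
    extD B y = ∑ i, covectorWedge (LinearMap.toContinuousLinearMap (e.coord i))
      (formDeriv B y (e i)) := by
  funext k
  rw [Finset.sum_apply]
  cases k with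
  | zero => exact (Finset.sum_eq_zero fun i _ => rfl).symm
  | succ k =>
    ext v
    rw [ContinuousAlternatingMap.sum_apply]
    simp only [covectorWedge_apply_succ, wedgeCovector_apply]
    rw [Finset.sum_comm, extD, extDeriv, ContinuousAlternatingMap.alternatizeUncurryFin_apply]
    refine Finset.sum_congr rfl fun j _ => ?_
    conv_lhs => rw [← e.sum_repr (v j)]
    simp only [map_sum, map_smul, ContinuousAlternatingMap.sum_apply,
      ContinuousAlternatingMap.smul_apply, Finset.smul_sum, formDeriv, smul_eq_mul]
    rfl

/-- A form concentrated in the top degree is annihilated by the exterior product with any covector. -/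
theorem covectorWedge_eq_zero_of_top {n : ℕ} (hn : Module.finrank ℝ E = n) {Ω : ExtForm E}
    (hΩ : ∀ k, k ≠ n → Ω k = 0) (α : E →L[ℝ] ℝ) : covectorWedge α Ω = 0 := by
  funext k
  cases k with
  | zero => rfl
  | succ k =>
    ext v
    by_cases hk : k = n
    · -- the degree `n + 1` exceeds the dimension
      subst hk
      refine AlternatingMap.map_linearDependent (covectorWedge α Ω (k + 1)).toAlternatingMap v ?_
      intro hv
      have := hv.fintype_card_le_finrank
      simp [hn] at this
    · simp [covectorWedge_apply_succ, wedgeCovector_apply, hΩ k hk]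

end Calculus

/-! ### The exterior derivative and its commutators with insertions -/

section LocalOperators

variable {E : Type*} [NormedAddCommGroup E] [NormedSpace ℝ E]

theorem contDiffOn_extD {B : E → ExtForm E} {U : Set E} (hU : IsOpen U)
    (hB : ∀ k, ContDiffOn ℝ ∞ (fun y => B y k) U) (k : ℕ) :
    ContDiffOn ℝ ∞ (fun y => extD B y k) U := by
  cases k with
  | zero => exact contDiffOn_const
  | succ k =>
    exact (ContinuousAlternatingMap.alternatizeUncurryFinCLM ℝ E ℝ).contDiff.comp_contDiffOn
      ((hB k).fderiv_of_isOpen (m := ∞) hU le_rfl)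

theorem extD_extD {B : E → ExtForm E} {y : E} (hB : ∀ k, ContDiffAt ℝ ∞ (fun z => B z k) y) :
    extD (extD B) y = 0 := by
  funext k
  match k with
  | 0 => rfl
  | 1 =>
    have h : fderiv ℝ (fun z => extD B z 0) y = 0 := fderiv_const_apply _
    rw [extD, extDeriv, h]
    exact (ContinuousAlternatingMap.alternatizeUncurryFinCLM ℝ E ℝ).map_zero
  | k + 2 => exact extDeriv_extDeriv_apply (hB k) (by
    rw [minSmoothness_of_isRCLikeNormedField]
    exact ENat.LEInfty.out)

theorem extD_congr {B C : E → ExtForm E}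
    {y : E} (h : B =ᶠ[nhds y] C) : extD B y = extD C y := by
  funext k
  cases k with
  | zero => rfl
  | succ k => exact Filter.EventuallyEq.extDeriv_eq (h.mono fun z hz => congrFun hz k)

theorem extD_add {B C : E → ExtForm E} {y : E}
    (hB : ∀ k, DifferentiableAt ℝ (fun z => B z k) y)
    (hC : ∀ k, DifferentiableAt ℝ (fun z => C z k) y) :
    extD (fun z => B z + C z) y = extD B y + extD C y := by
  funext k
  cases k with
  | zero => exact (add_zero _).symm
  | succ k => exact extDeriv_add (hB k) (hC k)

theorem extD_const_smul (c : ℝ) (B : E → ExtForm E) (y : E) :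
    extD (fun z => c • B z) y = c • extD B y := by
  funext k
  cases k with
  | zero => exact (smul_zero c).symm
  | succ k => exact extDeriv_smul c _

variable [FiniteDimensional ℝ E]

theorem sum_covectorWedge_smul {ι : Type*} [Fintype ι] (e : Module.Basis ι ℝ E) (α : E →L[ℝ] ℝ)
    (β : ExtForm E) :
    ∑ i, covectorWedge (LinearMap.toContinuousLinearMap (e.coord i)) (α (e i) • β) =
      covectorWedge α β := by
  funext k
  rw [Finset.sum_apply]
  cases k with
  | zero => exact Finset.sum_eq_zero fun i _ => rfl
  | succ k =>
    ext v
    rw [ContinuousAlternatingMap.sum_apply]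
    simp only [covectorWedge_apply_succ, wedgeCovector_apply]
    rw [Finset.sum_comm]
    refine Finset.sum_congr rfl fun j _ => ?_
    conv_rhs => rw [← e.sum_repr (v j)]
    simp only [map_sum, map_smul, smul_eq_mul, Finset.sum_mul, Finset.smul_sum]
    refine Finset.sum_congr rfl fun i _ => ?_
    simp [mul_assoc]

/-- The Leibniz rule `d(fβ) = df ∧ β + f dβ`. -/
theorem extD_smul {f : E → ℝ} {B : E → ExtForm E} {y : E} (hf : DifferentiableAt ℝ f y)
    (hB : ∀ k, DifferentiableAt ℝ (fun z => B z k) y) :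
    extD (fun z => f z • B z) y = covectorWedge (fderiv ℝ f y) (B y) + f y • extD B y := by
  let e := Module.finBasis ℝ E
  have h : ∀ v, formDeriv (fun z => f z • B z) y v =
      fderiv ℝ f y v • B y + f y • formDeriv B y v := by
    intro v
    funext k
    change fderiv ℝ (fun z => f z • B z k) y v = _
    rw [fderiv_fun_smul hf (hB k), add_comm]
    rfl
  simp only [extD_eq_sum e, h, map_add, Finset.sum_add_distrib, sum_covectorWedge_smul]
  simp only [map_smul, Finset.smul_sum]

/-- The operator `[L_P, i_X]` for a bivector field `P` and a vector field `X` acts on forms as the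
insertion of a bivector: all derivatives of the form cancel. The bivector is the Schouten bracket
`∑ᵢ -(eⁱ ⌋ P) ∧ ∂ᵢX - Xⁱ ∂ᵢP`. -/
theorem exists_schouten {P X : E → ExteriorAlgebra ℝ E} {y : E}
    (hP : ∀ ℓ : Module.Dual ℝ (ExteriorAlgebra ℝ E), DifferentiableAt ℝ (fun z => ℓ (P z)) y)
    (hX : ∀ ℓ : Module.Dual ℝ (ExteriorAlgebra ℝ E), DifferentiableAt ℝ (fun z => ℓ (X z)) y)
    (hP2 : ∀ z, P z ∈ ⋀[ℝ]^2 E) (hX1 : ∀ z, X z ∈ ⋀[ℝ]^1 E) :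
    ∃ S ∈ ⋀[ℝ]^2 E, ∀ B : E → ExtForm E,
      (∀ k, DifferentiableAt ℝ (fun z => B z k) y) →
      (∀ k, DifferentiableAt ℝ (fun z => insertion E (X z) (B z) k) y) →
      insertion E (P y) (extD (fun z => insertion E (X z) (B z)) y) -
        extD (fun z => insertion E (P z) (insertion E (X z) (B z))) y +
        (insertion E (X y) (insertion E (P y) (extD B y)) -
          insertion E (X y) (extD (fun z => insertion E (P z) (B z)) y)) =
      insertion E S (B y) := by
  let e := Module.finBasis ℝ E
  let α : ∀ i, E →L[ℝ] ℝ := fun i => LinearMap.toContinuousLinearMap (e.coord i)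
  have hPd : ∀ i, weakDeriv P y (e i) ∈ ⋀[ℝ]^2 E := fun i => weakDeriv_mem hP _ hP2 _
  have hXd : ∀ i, weakDeriv X y (e i) ∈ ⋀[ℝ]^1 E := fun i => weakDeriv_mem hX _ hX1 _
  obtain ⟨x, hx⟩ := mem_exteriorPower_one.1 (hX1 y)
  choose x' hx' using fun i => mem_exteriorPower_one.1 (hXd i)
  choose V hV using fun i => mem_exteriorPower_one.1
    (contractLeft_mem_exteriorPower_one (α i).toLinearMap (hP2 y))
  refine ⟨∑ i, (-(ExteriorAlgebra.ι ℝ (V i) * ExteriorAlgebra.ι ℝ (x' i)) -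
    α i x • weakDeriv P y (e i)), ?_, ?_⟩
  · refine Submodule.sum_mem _ fun i _ => sub_mem (neg_mem ?_) (Submodule.smul_mem _ _ (hPd i))
    exact SetLike.mul_mem_graded (A := fun i : ℕ => ⋀[ℝ]^i E) (ι_mem_exteriorPower_one (V i))
      (ι_mem_exteriorPower_one (x' i))
  · intro B hB hXB
    -- expand everything in `d = ∑ᵢ eⁱ ∧ ∂ᵢ`; the identity then holds for each summand
    simp only [extD_eq_sum e, formDeriv_insertion hP hXB, formDeriv_insertion hP hB,
      formDeriv_insertion hX hB, map_sum, LinearMap.sum_apply, ← Finset.sum_sub_distrib,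
      ← Finset.sum_add_distrib]
    refine Finset.sum_congr rfl fun i _ => ?_
    change insertion E (P y) (covectorWedge (α i) _) - covectorWedge (α i) _ +
      (insertion E (X y) (insertion E (P y) (covectorWedge (α i) _)) -
        insertion E (X y) (covectorWedge (α i) _)) = _
    have hc : ∀ β, insertion E (P y) (covectorWedge (α i) β) =
        covectorWedge (α i) (insertion E (P y) β) - vectorInsertion E (V i) β := by
      intro β
      rw [insertion_covectorWedge (α i) (hP2 y), ← hV, insertion_ι]
    rw [← hx, ← hx', insertion_ι, insertion_ι]
    simp only [hc, map_add, map_sub, map_neg, map_smul, map_mul, insertion_ι,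
      vectorInsertion_covectorWedge, LinearMap.sub_apply, LinearMap.neg_apply,
      LinearMap.smul_apply, Module.End.mul_apply, insertion_vectorInsertion_comm x (hPd i),
      vectorInsertion_anticomm x (V i)]
    abel

end LocalOperators

/-! ### Chart expressions -/

section Charts

variable {n : ℕ} {M : Type*} [TopologicalSpace M] [ChartedSpace (EuclideanSpace ℝ (Fin n)) M]

/-- The expression of all components of a form in the chart at `x₀`. -/
def FormField.localRep (β : FormField n M) (x₀ : M) (y : EuclideanSpace ℝ (Fin n)) :
    ExtForm (EuclideanSpace ℝ (Fin n)) := fun k => β.inChart x₀ k y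

theorem localRep_add (β γ : FormField n M) (x₀ : M) (y : EuclideanSpace ℝ (Fin n)) :
    (β + γ).localRep x₀ y = β.localRep x₀ y + γ.localRep x₀ y := rfl

theorem localRep_smul (c : ℝ) (β : FormField n M) (x₀ : M) (y : EuclideanSpace ℝ (Fin n)) :
    (c • β).localRep x₀ y = c • β.localRep x₀ y := rfl

theorem localRep_sub (β γ : FormField n M) (x₀ : M) (y : EuclideanSpace ℝ (Fin n)) :
    (β - γ).localRep x₀ y = β.localRep x₀ y - γ.localRep x₀ y := rfl

theorem IsSmoothForm.contDiffAt {β : FormField n M} (hβ : IsSmoothForm β) {x₀ : M}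
    {y : EuclideanSpace ℝ (Fin n)} (hy : y ∈ (extChartAt (𝓡 n) x₀).target) (k : ℕ) :
    ContDiffAt ℝ ∞ (fun z => β.localRep x₀ z k) y :=
  (hβ x₀ k).contDiffAt (extChartAt_target_mem_nhds' hy)

theorem IsSmoothForm.differentiableAt {β : FormField n M} (hβ : IsSmoothForm β) {x₀ : M}
    {y : EuclideanSpace ℝ (Fin n)} (hy : y ∈ (extChartAt (𝓡 n) x₀).target) (k : ℕ) :
    DifferentiableAt ℝ (fun z => β.localRep x₀ z k) y :=
  (hβ.contDiffAt hy k).differentiableAt (by simp)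

theorem IsSmoothForm.add {β γ : FormField n M} (hβ : IsSmoothForm β) (hγ : IsSmoothForm γ) :
    IsSmoothForm (β + γ) := fun x₀ k => (hβ x₀ k).add (hγ x₀ k)

theorem IsSmoothForm.const_smul {β : FormField n M} (hβ : IsSmoothForm β) (c : ℝ) :
    IsSmoothForm (c • β) := fun x₀ k => (hβ x₀ k).const_smul c

/-- The pullback of a form at a point depends only on the point and the linear map. Tangent spaces at
different points are definitionally the model space, which allows stating this without casts. -/
theorem pullback_congr_point (β : FormField n M) {p q : M} (h : p = q)
    (A B : EuclideanSpace ℝ (Fin n) →L[ℝ] EuclideanSpace ℝ (Fin n)) (hAB : ∀ v, A v = B v) (k : ℕ) :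
    (ContinuousAlternatingMap.compContinuousLinearMap (β p k) A :
      EuclideanSpace ℝ (Fin n) [⋀^Fin k]→L[ℝ] ℝ) =
    ContinuousAlternatingMap.compContinuousLinearMap (β q k) B := by
  obtain rfl : A = B := ContinuousLinearMap.ext hAB
  subst h
  rfl

variable [IsManifold (𝓡 n) ∞ M]

/-- The derivatives of a chart and of its inverse are inverse to each other. -/
theorem mfderiv_symm_mfderiv {x₀ : M} {y : EuclideanSpace ℝ (Fin n)}
    (hy : y ∈ (extChartAt (𝓡 n) x₀).target)
    (v : TangentSpace (𝓡 n) ((extChartAt (𝓡 n) x₀).symm y)) :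
    mfderiv 𝓘(ℝ, EuclideanSpace ℝ (Fin n)) (𝓡 n) (extChartAt (𝓡 n) x₀).symm y
      (mfderiv (𝓡 n) 𝓘(ℝ, EuclideanSpace ℝ (Fin n)) (extChartAt (𝓡 n) x₀)
        ((extChartAt (𝓡 n) x₀).symm y) v) = v := by
  have : IsManifold (𝓡 n) 1 M := IsManifold.of_le (n := ∞) (by exact_mod_cast le_top)
  have h := mfderivWithin_extChartAt_symm_comp_mfderiv_extChartAt (I := 𝓡 n) hy
  rw [ModelWithCorners.range_eq_univ, mfderivWithin_univ] at h
  exact DFunLike.congr_fun h v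

/-- The expression of a form in a chart determines the form at each point of the chart. -/
theorem localRep_injective {x₀ : M} {y : EuclideanSpace ℝ (Fin n)}
    (hy : y ∈ (extChartAt (𝓡 n) x₀).target) {β γ : FormField n M}
    (h : β.localRep x₀ y = γ.localRep x₀ y) :
    β ((extChartAt (𝓡 n) x₀).symm y) = γ ((extChartAt (𝓡 n) x₀).symm y) :=
  pullback_injective (fun v => mfderiv_symm_mfderiv hy v) h

theorem ext_of_localRep {β γ : FormField n M}
    (h : ∀ x₀ : M, ∀ y ∈ (extChartAt (𝓡 n) x₀).target, β.localRep x₀ y = γ.localRep x₀ y) : β = γ := by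
  funext x
  have h1 := localRep_injective (mem_extChartAt_target x) (h x _ (mem_extChartAt_target x))
  rwa [extChartAt_to_inv] at h1

theorem localRep_ins (Q : MultiVec n M) (β : FormField n M) {x₀ : M} {y : EuclideanSpace ℝ (Fin n)}
    (hy : y ∈ (extChartAt (𝓡 n) x₀).target) :
    (ins Q β).localRep x₀ y = insertion (EuclideanSpace ℝ (Fin n)) (Q.inChart x₀ y) (β.localRep x₀ y) :=
  (insertion_map_pullback (fun v => mfderiv_symm_mfderiv hy v) _ _).symm

end Charts

/-! ### The exterior derivative on a manifold -/

section Naturality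

variable {n : ℕ} {M : Type*} [TopologicalSpace M] [ChartedSpace (EuclideanSpace ℝ (Fin n)) M]
  [IsManifold (𝓡 n) ∞ M]

theorem contDiffAt_transition {x₀ p : M} {z : EuclideanSpace ℝ (Fin n)}
    (hz : z ∈ (extChartAt (𝓡 n) x₀).target)
    (hp : (extChartAt (𝓡 n) x₀).symm z ∈ (extChartAt (𝓡 n) p).source) :
    ContDiffAt ℝ ∞ (extChartAt (𝓡 n) p ∘ (extChartAt (𝓡 n) x₀).symm) z := by
  have h := contDiffWithinAt_ext_coord_change (I := 𝓡 n) (n := ∞) p x₀ (y := z)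
    (by simpa using ⟨by simpa using hz, by simpa using hp⟩)
  rwa [ModelWithCorners.range_eq_univ, contDiffWithinAt_univ] at h

theorem fderiv_transition {x₀ p : M} {z : EuclideanSpace ℝ (Fin n)}
    (hz : z ∈ (extChartAt (𝓡 n) x₀).target)
    (hp : (extChartAt (𝓡 n) x₀).symm z ∈ (extChartAt (𝓡 n) p).source) :
    fderiv ℝ (extChartAt (𝓡 n) p ∘ (extChartAt (𝓡 n) x₀).symm) z =
      (mfderiv (𝓡 n) 𝓘(ℝ, EuclideanSpace ℝ (Fin n)) (extChartAt (𝓡 n) p)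
        ((extChartAt (𝓡 n) x₀).symm z)).comp
      (mfderiv 𝓘(ℝ, EuclideanSpace ℝ (Fin n)) (𝓡 n) (extChartAt (𝓡 n) x₀).symm z) := by
  have : IsManifold (𝓡 n) 1 M := IsManifold.of_le (n := ∞) (by exact_mod_cast le_top)
  rw [← mfderiv_eq_fderiv]
  refine mfderiv_comp z (mdifferentiableAt_extChartAt (by simpa using hp)) ?_
  have h := mdifferentiableWithinAt_extChartAt_symm (I := 𝓡 n) hz
  rwa [ModelWithCorners.range_eq_univ, mdifferentiableWithinAt_univ] at h

/-- The chart expressions of a form are related by pullback along the transition maps. -/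
theorem inChart_transition (β : FormField n M) {x₀ p : M} {z : EuclideanSpace ℝ (Fin n)}
    (hz : z ∈ (extChartAt (𝓡 n) x₀).target)
    (hp : (extChartAt (𝓡 n) x₀).symm z ∈ (extChartAt (𝓡 n) p).source) (k : ℕ) :
    (β.inChart p k ((extChartAt (𝓡 n) p ∘ (extChartAt (𝓡 n) x₀).symm) z)).compContinuousLinearMap
      (fderiv ℝ (extChartAt (𝓡 n) p ∘ (extChartAt (𝓡 n) x₀).symm) z) = β.inChart x₀ k z := by
  have : IsManifold (𝓡 n) 1 M := IsManifold.of_le (n := ∞) (by exact_mod_cast le_top)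
  refine pullback_congr_point β ((extChartAt (𝓡 n) p).left_inv hp)
    (ContinuousLinearMap.comp
      (mfderiv 𝓘(ℝ, EuclideanSpace ℝ (Fin n)) (𝓡 n) (extChartAt (𝓡 n) p).symm
        (extChartAt (𝓡 n) p ((extChartAt (𝓡 n) x₀).symm z)))
      (fderiv ℝ (extChartAt (𝓡 n) p ∘ (extChartAt (𝓡 n) x₀).symm) z))
    (mfderiv 𝓘(ℝ, EuclideanSpace ℝ (Fin n)) (𝓡 n) (extChartAt (𝓡 n) x₀).symm z) ?_ k
  have h := mfderivWithin_extChartAt_symm_comp_mfderiv_extChartAt' (I := 𝓡 n) hp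
  rw [ModelWithCorners.range_eq_univ, mfderivWithin_univ] at h
  intro v
  exact (congrArg (mfderiv 𝓘(ℝ, EuclideanSpace ℝ (Fin n)) (𝓡 n) (extChartAt (𝓡 n) p).symm
    (extChartAt (𝓡 n) p ((extChartAt (𝓡 n) x₀).symm z)))
      (DFunLike.congr_fun (fderiv_transition hz hp) v)).trans (DFunLike.congr_fun h
    (mfderiv 𝓘(ℝ, EuclideanSpace ℝ (Fin n)) (𝓡 n) (extChartAt (𝓡 n) x₀).symm z v))

/-- The exterior derivative is computed by the same formula in every chart, because the exterior
derivative on a normed space commutes with pullback along the transition maps. -/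
theorem localRep_d {β : FormField n M} (hβ : IsSmoothForm β) {x₀ : M} {y : EuclideanSpace ℝ (Fin n)}
    (hy : y ∈ (extChartAt (𝓡 n) x₀).target) : (d β).localRep x₀ y = extD (β.localRep x₀) y := by
  funext k
  cases k with
  | zero => rfl
  | succ k =>
    -- by definition, `d β` at `p` is computed in the chart at `p`
    let p := (extChartAt (𝓡 n) x₀).symm y
    have hp : p ∈ (extChartAt (𝓡 n) p).source := mem_extChartAt_source p
    have h1 : (d β).localRep x₀ y (k + 1) =
        (extDeriv (β.inChart p k) ((extChartAt (𝓡 n) p ∘ (extChartAt (𝓡 n) x₀).symm)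
          y)).compContinuousLinearMap
        (fderiv ℝ (extChartAt (𝓡 n) p ∘ (extChartAt (𝓡 n) x₀).symm) y) := by
      rw [fderiv_transition hy hp]
      rfl
    refine h1.trans ((extDeriv_pullback (r := ∞)
      (f := extChartAt (𝓡 n) p ∘ (extChartAt (𝓡 n) x₀).symm)
      (hβ.differentiableAt (mem_extChartAt_target p) k) (contDiffAt_transition hy hp)
      (by rw [minSmoothness_of_isRCLikeNormedField]; exact ENat.LEInfty.out)).symm.trans ?_)
    refine Filter.EventuallyEq.extDeriv_eq ?_
    have hc : ContinuousAt (extChartAt (𝓡 n) x₀).symm y := continuousAt_extChartAt_symm'' hy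
    filter_upwards [extChartAt_target_mem_nhds' hy,
      hc.preimage_mem_nhds (extChartAt_source_mem_nhds (I := 𝓡 n) p)] with z hz hz'
    exact inChart_transition β hz hz' k

theorem IsSmoothForm.d {β : FormField n M} (hβ : IsSmoothForm β) : IsSmoothForm (d β) :=
  fun x₀ k => (contDiffOn_extD (isOpen_extChartAt_target x₀) (fun k => hβ x₀ k) k).congr
    fun _ hy => congrFun (localRep_d hβ hy) k

theorem IsSmoothForm.ins {β : FormField n M} (hβ : IsSmoothForm β) {Q : MultiVec n M}
    (hQ : ∀ x₀, WeaklySmoothOn (Q.inChart x₀) (extChartAt (𝓡 n) x₀).target) :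
    IsSmoothForm (ins Q β) :=
  fun x₀ k => (contDiffOn_insertion (hQ x₀) (fun k => hβ x₀ k) k).congr
    fun _ hy => congrFun (localRep_ins Q β hy) k

theorem localRep_eventuallyEq_ins (Q : MultiVec n M) (β : FormField n M) {x₀ : M}
    {y : EuclideanSpace ℝ (Fin n)} (hy : y ∈ (extChartAt (𝓡 n) x₀).target) :
    (ins Q β).localRep x₀ =ᶠ[nhds y]
      fun z => insertion (EuclideanSpace ℝ (Fin n)) (Q.inChart x₀ z) (β.localRep x₀ z) := by
  filter_upwards [extChartAt_target_mem_nhds' hy] with z hz using localRep_ins Q β hz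

theorem localRep_eventuallyEq_d {β : FormField n M} (hβ : IsSmoothForm β) {x₀ : M}
    {y : EuclideanSpace ℝ (Fin n)} (hy : y ∈ (extChartAt (𝓡 n) x₀).target) :
    (d β).localRep x₀ =ᶠ[nhds y] extD (β.localRep x₀) := by
  filter_upwards [extChartAt_target_mem_nhds' hy] with z hz using localRep_d hβ hz

theorem d_d {β : FormField n M} (hβ : IsSmoothForm β) : d (d β) = 0 := by
  refine ext_of_localRep fun x₀ y hy => ?_
  rw [localRep_d hβ.d hy, extD_congr (localRep_eventuallyEq_d hβ hy),
    extD_extD fun k => hβ.contDiffAt hy k]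
  rfl

theorem d_add {β γ : FormField n M} (hβ : IsSmoothForm β) (hγ : IsSmoothForm γ) :
    d (β + γ) = d β + d γ := by
  refine ext_of_localRep fun x₀ y hy => ?_
  rw [localRep_d (hβ.add hγ) hy, localRep_add, localRep_d hβ hy, localRep_d hγ hy]
  exact extD_add (hβ.differentiableAt hy) (hγ.differentiableAt hy)

theorem d_smul {β : FormField n M} (hβ : IsSmoothForm β) (c : ℝ) : d (c • β) = c • d β := by
  refine ext_of_localRep fun x₀ y hy => ?_
  rw [localRep_d (hβ.const_smul c) hy, localRep_smul, localRep_d hβ hy]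
  exact extD_const_smul c (β.localRep x₀) y

end Naturality

/-! ### Identities between graded commutators -/

section GradedCommutators

/-! In this section `d`, `P`, `X`, `H`, `N` are elements of a ring, standing for the exterior
derivative, the insertions of a bivector field and of two vector fields, and the multiplication by a
function. The elements `L`, `LX`, `LH` and `M` are the graded commutators of `P`, `X`, `H` and of a
further bivector with `d`. -/

variable {R : Type*} [Ring R] {d P X H N L LX LH M : R}

/-- `[L_P, d] = 0`. -/
theorem lie_anticomm_d (hd : d * d = 0) (hL : L = P * d - d * P) : L * d = -(d * L) := by
  linear_combination (norm := noncomm_ring) hL * d + d * hL + P * hd - hd * P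

/-- `⟦P, P⟧ = 0` implies `L_P² = 0`. -/
theorem lie_sq_eq_zero [Algebra ℝ R] (hd : d * d = 0) (hL : L = P * d - d * P)
    (hP : L * P = P * L) : L * L = 0 := by
  have hLd := lie_anticomm_d hd hL
  -- moving the two factors of `L = P d - d P` past the other `L` gives `L² = -L²`
  have h : (2 : ℝ) • (L * L) = 0 := by
    rw [two_smul]
    linear_combination (norm := noncomm_ring)
      L * hL + hP * d + P * hLd - hLd * P + d * hP + hL * L
  exact (smul_eq_zero.1 h).resolve_left two_ne_zero

/-- `⟦P, ⟦P, ν⟧⟧ = 0`. -/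
theorem lie_anticomm_hamiltonian (hLL : L * L = 0) (hH : L * N - N * L = H) :
    L * H = -(H * L) := by
  linear_combination (norm := noncomm_ring) hLL * N - N * hLL - L * hH - hH * L

/-- `⟦X, P⟧ = 0` implies `[L_X, L_P] = 0`. -/
theorem lie_comm_lie (hLX : L * X = -(X * L)) (hLd : L * d = -(d * L)) (hX : LX = X * d + d * X) :
    LX * L = L * LX := by
  linear_combination (norm := noncomm_ring)
    hX * L - L * hX + X * hLd - hLX * d - hLd * X + d * hLX

/-- `⟦Ξ, ⟦P, ν⟧⟧ = 0`, since `⟦Ξ, P⟧ = 0` and `⟦P, Ξ(ν)⟧ = ⟦P, 1⟧ = 0`. -/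
theorem lie_comm_hamiltonian (hLXL : LX * L = L * LX) (hN : LX * N - N * LX = 1)
    (hH : L * N - N * L = H) : LX * H = H * LX := by
  linear_combination (norm := noncomm_ring)
    hLXL * N + L * hN - hN * L - N * hLXL - LX * hH + hH * LX

/-- Antisymmetry of the bracket of vector fields: `⟦X, H⟧ = 0` implies `⟦H, X⟧ = 0`. -/
theorem lie_comm_vector (hXH : X * H = -(H * X)) (hX : LX = X * d + d * X) (hH : LH = H * d + d * H)
    (hLXH : LX * H = H * LX) : LH * X = X * LH := by
  linear_combination (norm := noncomm_ring)
    hH * X - X * hH + hX * H - H * hX - hXH * d + d * hXH - hLXH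

/-- `L_{X ∧ H} = i_X L_H - L_X i_H`. -/
theorem lie_mul (hX : LX = X * d + d * X) (hH : LH = H * d + d * H) :
    X * H * d - d * (X * H) = X * LH - LX * H := by
  linear_combination (norm := noncomm_ring) hX * H - X * hH

/-- `⟦P, X ∧ H⟧ = 0` if `⟦P, X⟧ = 0` and `⟦P, H⟧ = 0`. -/
theorem lie_comm_mul (hLX : L * X = -(X * L)) (hLH : L * H = -(H * L)) :
    L * (X * H) = X * H * L := by
  linear_combination (norm := noncomm_ring) hLX * H - X * hLH

/-- Symmetry of the Schouten bracket of two bivector fields. -/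
theorem lie_comm_symm {T : R} (hTP : T * P = P * T) (hL : L = P * d - d * P)
    (hM : M = T * d - d * T) (h : L * T = T * L) : M * P = P * M := by
  linear_combination (norm := noncomm_ring)
    hM * P - P * hM - hL * T + T * hL + h + hTP * d - d * hTP

/-- `⟦X ∧ H, X ∧ H⟧ = 0` if `⟦X, H⟧ = 0`. -/
theorem lie_mul_comm_mul (hXX : X * X = 0) (hHH : H * H = 0) (hXH : X * H = -(H * X))
    (hM : M = X * LH - LX * H)
    (h3 : LX * H = H * LX) (h4 : LH * X = X * LH) : M * (X * H) = X * H * M := by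
  have ha : M * (X * H) = 0 := by
    linear_combination (norm := noncomm_ring) hM * (X * H) + X * h4 * H + hXX * LH * H
      - LX * hXH * H + LX * X * hHH
  have hb : X * H * M = 0 := by
    linear_combination (norm := noncomm_ring) X * H * hM + hXH * X * LH - H * hXX * LH
      + X * h3 * H - X * LX * hHH
  rw [ha, hb]

/-- If all brackets among the bivectors `P` and `T` vanish, then `⟦P + T, P + T⟧ = 0`. -/
theorem lie_comm_add {T : R} (hP : (P * d - d * P) * P = P * (P * d - d * P))
    (hT : (T * d - d * T) * T = T * (T * d - d * T))
    (hPT : (P * d - d * P) * T = T * (P * d - d * P))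
    (hTP : (T * d - d * T) * P = P * (T * d - d * T)) :
    ((P + T) * d - d * (P + T)) * (P + T) = (P + T) * ((P + T) * d - d * (P + T)) := by
  linear_combination (norm := noncomm_ring) hP + hT + hPT + hTP

end GradedCommutators

/-! ### Smooth multivector fields -/

section MultiVectorFields

variable {n : ℕ} {M : Type*} [TopologicalSpace M] [ChartedSpace (EuclideanSpace ℝ (Fin n)) M]

theorem inChart_add (Q R : MultiVec n M) (x₀ : M) (y : EuclideanSpace ℝ (Fin n)) :
    (Q + R).inChart x₀ y = Q.inChart x₀ y + R.inChart x₀ y :=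
  map_add (ExteriorAlgebra.map _) _ _

theorem inChart_mul (Q R : MultiVec n M) (x₀ : M) (y : EuclideanSpace ℝ (Fin n)) :
    (Q * R).inChart x₀ y = Q.inChart x₀ y * R.inChart x₀ y :=
  map_mul (ExteriorAlgebra.map _) _ _

theorem inChart_mem {k : ℕ} {Q : MultiVec n M} (hQ : IsMultiVectorField k Q) (x₀ : M)
    (y : EuclideanSpace ℝ (Fin n)) :
    Q.inChart x₀ y ∈ ⋀[ℝ]^k (EuclideanSpace ℝ (Fin n)) :=
  map_mem_exteriorPower _ k (hQ.1 _)

theorem IsMultiVectorField.weaklySmoothOn {k : ℕ} {Q : MultiVec n M} (hQ : IsMultiVectorField k Q)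
    (x₀ : M) : WeaklySmoothOn (Q.inChart x₀) (extChartAt (𝓡 n) x₀).target := hQ.2 x₀

theorem IsMultiVectorField.differentiableAt {k : ℕ} {Q : MultiVec n M}
    (hQ : IsMultiVectorField k Q) {x₀ : M} {y : EuclideanSpace ℝ (Fin n)}
    (hy : y ∈ (extChartAt (𝓡 n) x₀).target)
    (ℓ : Module.Dual ℝ (ExteriorAlgebra ℝ (EuclideanSpace ℝ (Fin n)))) :
    DifferentiableAt ℝ (fun z => ℓ (Q.inChart x₀ z)) y :=
  ((hQ.2 x₀ ℓ).contDiffAt (extChartAt_target_mem_nhds' hy)).differentiableAt (by simp)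

theorem IsMultiVectorField.add {k : ℕ} {Q R : MultiVec n M} (hQ : IsMultiVectorField k Q)
    (hR : IsMultiVectorField k R) : IsMultiVectorField k (Q + R) :=
  ⟨fun x => add_mem (hQ.1 x) (hR.1 x), fun x₀ =>
    ((hQ.weaklySmoothOn x₀).add (hR.weaklySmoothOn x₀)).congr fun y _ => inChart_add Q R x₀ y⟩

theorem IsMultiVectorField.mul {k l : ℕ} {Q R : MultiVec n M} (hQ : IsMultiVectorField k Q)
    (hR : IsMultiVectorField l R) : IsMultiVectorField (k + l) (Q * R) :=
  ⟨fun x => SetLike.mul_mem_graded (A := fun i : ℕ => ⋀[ℝ]^i (TangentSpace (𝓡 n) x))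
    (hQ.1 x) (hR.1 x), fun x₀ =>
    ((hQ.weaklySmoothOn x₀).bilinear (LinearMap.mul ℝ _) (hR.weaklySmoothOn x₀)).congr
      fun y _ => inChart_mul Q R x₀ y⟩

variable [IsManifold (𝓡 n) ∞ M]

theorem contDiffOn_comp_symm {f : M → ℝ} (hf : ContMDiff (𝓡 n) 𝓘(ℝ, ℝ) ∞ f) (x₀ : M) :
    ContDiffOn ℝ ∞ (f ∘ (extChartAt (𝓡 n) x₀).symm) (extChartAt (𝓡 n) x₀).target :=
  contMDiffOn_iff_contDiffOn.1 (hf.comp_contMDiffOn (contMDiffOn_extChartAt_symm x₀))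

/-- The differential of a function in a chart. -/
theorem fderiv_comp_symm {f : M → ℝ} (hf : ContMDiff (𝓡 n) 𝓘(ℝ, ℝ) ∞ f) {x₀ : M}
    {y : EuclideanSpace ℝ (Fin n)} (hy : y ∈ (extChartAt (𝓡 n) x₀).target)
    (v : EuclideanSpace ℝ (Fin n)) :
    fderiv ℝ (f ∘ (extChartAt (𝓡 n) x₀).symm) y v =
      mvfderiv (𝓡 n) f ((extChartAt (𝓡 n) x₀).symm y)
      (mfderiv 𝓘(ℝ, EuclideanSpace ℝ (Fin n)) (𝓡 n) (extChartAt (𝓡 n) x₀).symm y v) := by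
  have : IsManifold (𝓡 n) 1 M := IsManifold.of_le (n := ∞) (by exact_mod_cast le_top)
  have h := mdifferentiableWithinAt_extChartAt_symm (I := 𝓡 n) hy
  rw [ModelWithCorners.range_eq_univ, mdifferentiableWithinAt_univ] at h
  have h2 := mfderiv_comp y (hf.mdifferentiableAt (by simp)) h
  rw [mfderiv_eq_fderiv] at h2
  exact DFunLike.congr_fun h2 v

/-- The Hamiltonian vector field in a chart is given by the same formula, with the Fréchet derivative
of the function. -/
theorem inChart_hamiltonian (P : MultiVec n M) {f : M → ℝ} (hf : ContMDiff (𝓡 n) 𝓘(ℝ, ℝ) ∞ f)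
    {x₀ : M} {y : EuclideanSpace ℝ (Fin n)} (hy : y ∈ (extChartAt (𝓡 n) x₀).target) :
    (hamiltonian P f).inChart x₀ y = -CliffordAlgebra.contractLeft
      (fderiv ℝ (f ∘ (extChartAt (𝓡 n) x₀).symm) y).toLinearMap (P.inChart x₀ y) := by
  let p := (extChartAt (𝓡 n) x₀).symm y
  let A := (mfderiv (𝓡 n) 𝓘(ℝ, EuclideanSpace ℝ (Fin n)) (extChartAt (𝓡 n) x₀) p).toLinearMap
  let α : Module.Dual ℝ (EuclideanSpace ℝ (Fin n)) :=
    (fderiv ℝ (f ∘ (extChartAt (𝓡 n) x₀).symm) y).toLinearMap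
  have h2 := contractLeft_map A (α := α) (α' := (mvfderiv (𝓡 n) f p).toLinearMap) (fun v =>
    (fderiv_comp_symm hf hy _).trans (congrArg _ (mfderiv_symm_mfderiv hy v))) (P p)
  exact (map_neg (ExteriorAlgebra.map A) _).trans (congrArg Neg.neg h2.symm)

theorem IsMultiVectorField.hamiltonian {P : MultiVec n M} (hP : IsMultiVectorField 2 P) {f : M → ℝ}
    (hf : ContMDiff (𝓡 n) 𝓘(ℝ, ℝ) ∞ f) : IsMultiVectorField 1 (hamiltonian P f) := by
  refine ⟨fun x => neg_mem (contractLeft_mem_exteriorPower_one _ (hP.1 x)), fun x₀ => ?_⟩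
  have h1 : WeaklySmoothOn (fun y => (fderiv ℝ (f ∘ (extChartAt (𝓡 n) x₀).symm) y).toLinearMap)
      (extChartAt (𝓡 n) x₀).target := by
    intro ℓ
    have h2 := (contDiffOn_comp_symm hf x₀).fderiv_of_isOpen (m := ∞)
      (isOpen_extChartAt_target x₀) le_rfl
    exact (LinearMap.toContinuousLinearMap
      (ℓ.comp (ContinuousLinearMap.coeLM ℝ :
        (EuclideanSpace ℝ (Fin n) →L[ℝ] ℝ) →ₗ[ℝ] _))).contDiff.comp_contDiffOn h2
  exact (h1.bilinear (-CliffordAlgebra.contractLeft) (hP.weaklySmoothOn x₀)).congr fun y hy =>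
    inChart_hamiltonian P hf hy

theorem weaklySmoothOn_ofFunction {f : M → ℝ} (hf : ContMDiff (𝓡 n) 𝓘(ℝ, ℝ) ∞ f) (x₀ : M) :
    WeaklySmoothOn ((ofFunction f : MultiVec n M).inChart x₀) (extChartAt (𝓡 n) x₀).target := by
  intro ℓ
  have h : ∀ y, (ofFunction f : MultiVec n M).inChart x₀ y =
      (f ∘ (extChartAt (𝓡 n) x₀).symm) y • 1 := fun y =>
    (AlgHom.commutes (ExteriorAlgebra.map _) _).trans (Algebra.algebraMap_eq_smul_one _)
  simp only [h, map_smul, smul_eq_mul]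
  exact (contDiffOn_comp_symm hf x₀).mul contDiffOn_const

end MultiVectorFields

section Pointwise

variable {n : ℕ} {M : Type*} [TopologicalSpace M] [ChartedSpace (EuclideanSpace ℝ (Fin n)) M]

theorem ins_mul (Q R : MultiVec n M) (β : FormField n M) : ins (Q * R) β = ins Q (ins R β) := by
  funext x
  exact LinearMap.congr_fun (map_mul (insertion (TangentSpace (𝓡 n) x)) (Q x) (R x)) (β x)

theorem ins_add (Q R : MultiVec n M) (β : FormField n M) : ins (Q + R) β = ins Q β + ins R β := by
  funext x
  exact LinearMap.congr_fun (map_add (insertion (TangentSpace (𝓡 n) x)) (Q x) (R x)) (β x)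

theorem ins_zero (β : FormField n M) : ins 0 β = 0 := by
  funext x
  exact LinearMap.congr_fun (map_zero (insertion (TangentSpace (𝓡 n) x))) (β x)

theorem ins_ofFunction (f : M → ℝ) (β : FormField n M) :
    ins (ofFunction f) β = fun x => f x • β x := by
  funext x
  exact LinearMap.congr_fun (AlgHom.commutes (insertion (TangentSpace (𝓡 n) x)) (f x)) (β x)

theorem ins_ofFunction_comm (f : M → ℝ) (Q : MultiVec n M) (β : FormField n M) :
    ins (ofFunction f) (ins Q β) = ins Q (ins (ofFunction f) β) := by
  rw [← ins_mul, ← ins_mul]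
  congr 1
  funext x
  exact Algebra.commutes (A := ExteriorAlgebra ℝ (TangentSpace (𝓡 n) x)) (f x) (Q x)

theorem ins_comm_of_even {Q X : MultiVec n M} (hQ : ∀ x, Q x ∈ ⋀[ℝ]^2 (TangentSpace (𝓡 n) x))
    (hX : ∀ x, X x ∈ ⋀[ℝ]^1 (TangentSpace (𝓡 n) x)) (β : FormField n M) :
    ins Q (ins X β) = ins X (ins Q β) := by
  funext x
  obtain ⟨v, hv⟩ := mem_exteriorPower_one.1 (hX x)
  have h := insertion_vectorInsertion_comm v (hQ x) (β x)
  rw [← insertion_ι, hv] at h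
  exact h

theorem ins_anticomm {X Y : MultiVec n M} (hX : ∀ x, X x ∈ ⋀[ℝ]^1 (TangentSpace (𝓡 n) x))
    (hY : ∀ x, Y x ∈ ⋀[ℝ]^1 (TangentSpace (𝓡 n) x)) (β : FormField n M) :
    ins X (ins Y β) = -ins Y (ins X β) := by
  funext x
  obtain ⟨v, hv⟩ := mem_exteriorPower_one.1 (hX x)
  obtain ⟨w, hw⟩ := mem_exteriorPower_one.1 (hY x)
  have h := vectorInsertion_anticomm v w (β x)
  rw [← insertion_ι, ← insertion_ι, hv, hw] at h
  exact h

theorem ins_self {X : MultiVec n M} (hX : ∀ x, X x ∈ ⋀[ℝ]^1 (TangentSpace (𝓡 n) x))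
    (β : FormField n M) : ins X (ins X β) = 0 := by
  funext x
  obtain ⟨v, hv⟩ := mem_exteriorPower_one.1 (hX x)
  have h := vectorInsertion_self v (β x)
  rw [← insertion_ι, hv] at h
  exact h

theorem ins_add_right (Q : MultiVec n M) (β γ : FormField n M) :
    ins Q (β + γ) = ins Q β + ins Q γ := by
  funext x
  exact map_add (insertion (TangentSpace (𝓡 n) x) (Q x)) (β x) (γ x)

theorem ins_sub_right (Q : MultiVec n M) (β γ : FormField n M) :
    ins Q (β - γ) = ins Q β - ins Q γ := by
  funext x
  exact map_sub (insertion (TangentSpace (𝓡 n) x) (Q x)) (β x) (γ x)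

theorem ins_smul_right (Q : MultiVec n M) (c : ℝ) (β : FormField n M) :
    ins Q (c • β) = c • ins Q β := by
  funext x
  exact map_smul (insertion (TangentSpace (𝓡 n) x) (Q x)) c (β x)

/-- If `X(f) = 1`, then `f` is a Casimir function of `P + X ∧ P_f`: as `P_f(f) = 0`, contraction
with `df` gives `df ⌋ P = -P_f` and `df ⌋ (X ∧ P_f) = P_f`. -/
theorem isCasimir_add {P : MultiVec n M} {f : M → ℝ} {X : ∀ x : M, TangentSpace (𝓡 n) x}
    (hX : ∀ x, mvfderiv (𝓡 n) f x (X x) = 1) :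
    IsCasimir (P + ofVectorField X * hamiltonian P f) f := by
  funext x
  have h1 : CliffordAlgebra.contractLeft (mvfderiv (𝓡 n) f x).toLinearMap (hamiltonian P f x) =
      0 := by
    rw [hamiltonian, map_neg, neg_eq_zero]
    exact CliffordAlgebra.contractLeft_contractLeft _ _
  have h2 := exterior_contractLeft_ι_mul (mvfderiv (𝓡 n) f x).toLinearMap (X x) (hamiltonian P f x)
  have h3 : (mvfderiv (𝓡 n) f x).toLinearMap (X x) = 1 := hX x
  rw [h1, mul_zero, sub_zero, h3, one_smul] at h2
  change -CliffordAlgebra.contractLeft (mvfderiv (𝓡 n) f x).toLinearMap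
    (P x + ExteriorAlgebra.ι ℝ (X x) * hamiltonian P f x) = 0
  rw [map_add, h2, hamiltonian, add_neg_cancel, neg_zero]

end Pointwise

/-! ### Operators on smooth forms -/

section SmoothForms

variable {n : ℕ} {M : Type*} [TopologicalSpace M] [ChartedSpace (EuclideanSpace ℝ (Fin n)) M]

variable (n M) in
/-- The submodule of smooth forms. -/
def smoothForms : Submodule ℝ (FormField n M) where
  carrier := {β | IsSmoothForm β}
  add_mem' := IsSmoothForm.add
  zero_mem' _ _ := (contDiffOn_const (c := 0)).congr fun _ _ => rfl
  smul_mem' c _ h := h.const_smul c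

variable (n M) in
/-- The type of smooth forms. It is a definition of its own, not an abbreviation of the subtype, so
that instance search finds only the additive group structure given below, and ring lemmas apply to
its endomorphisms without unfolding function types. -/
def SmoothForm : Type _ := smoothForms n M

instance : AddCommGroup (SmoothForm n M) := inferInstanceAs (AddCommGroup (smoothForms n M))

instance : Module ℝ (SmoothForm n M) := inferInstanceAs (Module ℝ (smoothForms n M))

/-- The form underlying a smooth form. -/
def SmoothForm.val (β : SmoothForm n M) : FormField n M := Subtype.val β

theorem SmoothForm.isSmoothForm (β : SmoothForm n M) : IsSmoothForm β.val := Subtype.property β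

theorem SmoothForm.ext {β γ : SmoothForm n M} (h : β.val = γ.val) : β = γ := Subtype.ext h

theorem SmoothForm.val_sub (β γ : SmoothForm n M) : (β - γ).val = β.val - γ.val := rfl

variable [IsManifold (𝓡 n) ∞ M]

variable (n M) in
/-- The exterior derivative as an operator on smooth forms. -/
def dOp : Module.End ℝ (SmoothForm n M) where
  toFun β := ⟨d β.val, β.isSmoothForm.d⟩
  map_add' β γ := SmoothForm.ext (d_add β.isSmoothForm γ.isSmoothForm)
  map_smul' c β := SmoothForm.ext (d_smul β.isSmoothForm c)

/-- The insertion of a smooth multivector field as an operator on smooth forms. -/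
def insOp (Q : MultiVec n M)
    (hQ : ∀ x₀, WeaklySmoothOn (Q.inChart x₀) (extChartAt (𝓡 n) x₀).target) :
    Module.End ℝ (SmoothForm n M) where
  toFun β := ⟨ins Q β.val, β.isSmoothForm.ins hQ⟩
  map_add' β γ := SmoothForm.ext (ins_add_right Q β.val γ.val)
  map_smul' c β := SmoothForm.ext (ins_smul_right Q c β.val)

theorem dOp_val (β : SmoothForm n M) : (dOp n M β).val = d β.val := rfl

theorem insOp_val (Q : MultiVec n M)
    (hQ : ∀ x₀, WeaklySmoothOn (Q.inChart x₀) (extChartAt (𝓡 n) x₀).target) (β : SmoothForm n M) :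
    (insOp Q hQ β).val = ins Q β.val := rfl

theorem dOp_mul_dOp : dOp n M * dOp n M = 0 :=
  LinearMap.ext fun β => SmoothForm.ext (d_d β.isSmoothForm)

variable {Q : MultiVec n M}
  {hQ : ∀ x₀, WeaklySmoothOn (Q.inChart x₀) (extChartAt (𝓡 n) x₀).target}

theorem lieDer_two_val (β : SmoothForm n M) :
    ((insOp Q hQ * dOp n M - dOp n M * insOp Q hQ) β).val = lieDer 2 Q β.val := by
  rw [lieDer, neg_one_sq, one_smul]
  rfl

/-- A smooth bivector field is Poisson if and only if its Lie derivative commutes with its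
insertion on smooth forms. -/
theorem isSchouten_self_iff : IsSchouten 2 2 Q Q 0 ↔
    (insOp Q hQ * dOp n M - dOp n M * insOp Q hQ) * insOp Q hQ =
      insOp Q hQ * (insOp Q hQ * dOp n M - dOp n M * insOp Q hQ) := by
  have key : ∀ β : SmoothForm n M,
      (lieDer 2 Q (ins Q β.val) - (-1 : ℝ) ^ ((2 + 1) * 2) • ins Q (lieDer 2 Q β.val)) =
        ((insOp Q hQ * dOp n M - dOp n M * insOp Q hQ) (insOp Q hQ β) -
          insOp Q hQ ((insOp Q hQ * dOp n M - dOp n M * insOp Q hQ) β)).val := by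
    intro β
    rw [SmoothForm.val_sub, lieDer_two_val, insOp_val, insOp_val, lieDer_two_val]
    norm_num
  constructor
  · intro h
    refine LinearMap.ext fun β => sub_eq_zero.1 (SmoothForm.ext ?_)
    have h1 := h β.val β.isSmoothForm
    rw [key, ins_zero] at h1
    exact h1.symm
  · intro h β hβ
    have h1 := LinearMap.congr_fun h (⟨β, hβ⟩ : smoothForms n M)
    exact (ins_zero β).trans
      ((congrArg SmoothForm.val (sub_eq_zero.2 h1)).symm.trans (key ⟨β, hβ⟩).symm)

/-- A form of top degree is closed. -/
theorem d_eq_zero_of_top {β : FormField n M} (hβ : ∀ x k, k ≠ n → β x k = 0) : d β = 0 := by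
  funext x k
  cases k with
  | zero => rfl
  | succ k =>
    have h : extDeriv (β.inChart x k) (extChartAt (𝓡 n) x x) = 0 := by
      by_cases hk : k = n
      · subst hk
        ext v
        refine AlternatingMap.map_linearDependent
          (extDeriv (β.inChart x k) (extChartAt (𝓡 k) x x)).toAlternatingMap v fun hv => ?_
        have := hv.fintype_card_le_finrank
        simp at this
      · have h0 : β.inChart x k = fun _ => 0 := by
          funext y
          ext v
          exact DFunLike.congr_fun (hβ ((extChartAt (𝓡 n) x).symm y) k hk) _
        rw [h0, extDeriv, fderiv_const_apply]
        exact (ContinuousAlternatingMap.alternatizeUncurryFinCLM ℝ _ ℝ).map_zero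
    change (extDeriv (β.inChart x k) (extChartAt (𝓡 n) x x)).compContinuousLinearMap
      (mfderiv (𝓡 n) 𝓘(ℝ, EuclideanSpace ℝ (Fin n)) (extChartAt (𝓡 n) x) x) = 0
    rw [h]
    rfl

/-- The Leibniz rule in a chart: the commutator of `d` with the multiplication by `f` is the
exterior multiplication by `df`. -/
theorem localRep_d_ofFunction {f : M → ℝ} (hf : ContMDiff (𝓡 n) 𝓘(ℝ, ℝ) ∞ f) {β : FormField n M}
    (hβ : IsSmoothForm β) {x₀ : M} {y : EuclideanSpace ℝ (Fin n)}
    (hy : y ∈ (extChartAt (𝓡 n) x₀).target) :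
    (d (ins (ofFunction f) β)).localRep x₀ y =
      covectorWedge (fderiv ℝ (f ∘ (extChartAt (𝓡 n) x₀).symm) y) (β.localRep x₀ y) +
        (ins (ofFunction f) (d β)).localRep x₀ y := by
  rw [localRep_d (hβ.ins (weaklySmoothOn_ofFunction hf)) hy, ins_ofFunction, ins_ofFunction]
  change extD (fun z => (f ∘ (extChartAt (𝓡 n) x₀).symm) z • β.localRep x₀ z) y =
    _ + (f ∘ (extChartAt (𝓡 n) x₀).symm) y • (d β).localRep x₀ y
  rw [localRep_d hβ hy]
  exact extD_smul (((contDiffOn_comp_symm hf x₀).contDiffAt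
    (extChartAt_target_mem_nhds' hy)).differentiableAt (by simp)) (hβ.differentiableAt hy)

/-- `[L_P, f] = i_{P_f}`. -/
theorem lie_ofFunction {P : MultiVec n M} (hP : IsMultiVectorField 2 P) {f : M → ℝ}
    (hf : ContMDiff (𝓡 n) 𝓘(ℝ, ℝ) ∞ f) :
    (insOp P hP.weaklySmoothOn * dOp n M - dOp n M * insOp P hP.weaklySmoothOn) *
        insOp (ofFunction f) (weaklySmoothOn_ofFunction hf) -
      insOp (ofFunction f) (weaklySmoothOn_ofFunction hf) *
        (insOp P hP.weaklySmoothOn * dOp n M - dOp n M * insOp P hP.weaklySmoothOn) =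
      insOp (hamiltonian P f) (hP.hamiltonian hf).weaklySmoothOn := by
  refine LinearMap.ext fun β => SmoothForm.ext ?_
  change ins P (d (ins (ofFunction f) β.val)) - d (ins P (ins (ofFunction f) β.val)) -
    ins (ofFunction f) (ins P (d β.val) - d (ins P β.val)) = ins (hamiltonian P f) β.val
  refine ext_of_localRep fun x₀ y hy => ?_
  rw [← ins_ofFunction_comm f P β.val, ins_sub_right, ins_ofFunction_comm f P (d β.val), localRep_sub, localRep_sub, localRep_sub,
    localRep_d_ofFunction hf (β.isSmoothForm.ins hP.weaklySmoothOn) hy, localRep_ins _ _ hy,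
    localRep_d_ofFunction hf β.isSmoothForm hy, map_add,
    insertion_covectorWedge _ (inChart_mem hP x₀ y), localRep_ins (hamiltonian P f) _ hy,
    inChart_hamiltonian P hf hy, map_neg, localRep_ins P β.val hy,
    localRep_ins P (ins (ofFunction f) (d β.val)) hy, LinearMap.neg_apply]
  abel

end SmoothForms

/-! ### The modular vector field preserves the Poisson structure -/

section Modular

variable {n : ℕ} {M : Type*} [TopologicalSpace M] [ChartedSpace (EuclideanSpace ℝ (Fin n)) M]
  [IsManifold (𝓡 n) ∞ M]

/-- The operator `[L_P, i_X]` vanishes as soon as it annihilates a volume form, because in every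
chart it is the insertion of a bivector. -/
theorem lie_anticomm_of_apply_volumeForm {Ω : FormField n M} (hΩ : IsVolumeForm Ω)
    {P X : MultiVec n M} (hP : IsMultiVectorField 2 P) (hX : IsMultiVectorField 1 X)
    (h : ins P (d (ins X Ω)) - d (ins P (ins X Ω)) + (ins X (ins P (d Ω)) - ins X (d (ins P Ω))) =
      0) {β : FormField n M} (hβ : IsSmoothForm β) :
    ins P (d (ins X β)) - d (ins P (ins X β)) + (ins X (ins P (d β)) - ins X (d (ins P β))) =
      0 := by
  refine ext_of_localRep fun x₀ y hy => ?_
  obtain ⟨S, hS2, hS⟩ := exists_schouten (hP.differentiableAt hy) (hX.differentiableAt hy)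
    (inChart_mem hP x₀) (inChart_mem hX x₀)
  have key : ∀ γ : FormField n M, IsSmoothForm γ →
      (ins P (d (ins X γ)) - d (ins P (ins X γ)) +
        (ins X (ins P (d γ)) - ins X (d (ins P γ)))).localRep x₀ y =
      insertion (EuclideanSpace ℝ (Fin n)) S (γ.localRep x₀ y) := by
    intro γ hγ
    have hXγ := hγ.ins hX.weaklySmoothOn
    have hPγ := hγ.ins hP.weaklySmoothOn
    have hPXγ := hXγ.ins hP.weaklySmoothOn
    have hd : ∀ k, DifferentiableAt ℝ (fun z => insertion (EuclideanSpace ℝ (Fin n))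
        (X.inChart x₀ z) (γ.localRep x₀ z) k) y := fun k =>
      (hXγ.differentiableAt hy k).congr_of_eventuallyEq
        ((localRep_eventuallyEq_ins X γ hy).symm.mono fun z hz => congrFun hz k)
    have hPX : (ins P (ins X γ)).localRep x₀ =ᶠ[nhds y] fun z =>
        insertion (EuclideanSpace ℝ (Fin n)) (P.inChart x₀ z)
          (insertion (EuclideanSpace ℝ (Fin n)) (X.inChart x₀ z) (γ.localRep x₀ z)) := by
      filter_upwards [extChartAt_target_mem_nhds' hy] with z hz
      rw [localRep_ins _ _ hz, localRep_ins _ _ hz]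
    rw [← hS _ (hγ.differentiableAt hy) hd, localRep_add, localRep_sub, localRep_sub]
    simp only [localRep_ins _ _ hy, localRep_d hγ hy, localRep_d hXγ hy, localRep_d hPγ hy, localRep_d hPXγ hy]
    rw [extD_congr hPX, extD_congr (localRep_eventuallyEq_ins X γ hy),
      extD_congr (localRep_eventuallyEq_ins P γ hy)]
  have hΩ0 : Ω.localRep x₀ y ≠ 0 := by
    intro h0
    have h1 := localRep_injective (β := Ω) (γ := 0) hy (h0.trans rfl)
    exact hΩ.2.2 _ (congrFun h1 n)
  have htop : ∀ k, k ≠ n → Ω.localRep x₀ y k = 0 := by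
    intro k hk
    ext v
    exact DFunLike.congr_fun (hΩ.2.1 ((extChartAt (𝓡 n) x₀).symm y) k hk) _
  have hSΩ := key Ω hΩ.1
  rw [h] at hSΩ
  let e := Module.finBasis ℝ (EuclideanSpace ℝ (Fin n))
  -- `S` annihilates the volume form, so it vanishes
  have hS0 : S = 0 := eq_zero_of_insertion_eq_zero e
    (fun i => (LinearMap.toContinuousLinearMap (e.coord i)).continuous) hΩ0
    (covectorWedge_eq_zero_of_top (by simp) htop) hS2 (hSΩ.symm.trans rfl)
  rw [key β hβ, hS0, map_zero]
  rfl

/-- `[L_X, f] = X(f)`, here for a vector field with `X(f) = 1`. -/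
theorem lie_vectorField_ofFunction {X : ∀ x : M, TangentSpace (𝓡 n) x}
    (hX : IsMultiVectorField 1 (ofVectorField X)) {f : M → ℝ}
    (hf : ContMDiff (𝓡 n) 𝓘(ℝ, ℝ) ∞ f) (hXf : ∀ x, mvfderiv (𝓡 n) f x (X x) = 1) :
    (insOp (ofVectorField X) hX.weaklySmoothOn * dOp n M +
        dOp n M * insOp (ofVectorField X) hX.weaklySmoothOn) *
        insOp (ofFunction f) (weaklySmoothOn_ofFunction hf) -
      insOp (ofFunction f) (weaklySmoothOn_ofFunction hf) *
        (insOp (ofVectorField X) hX.weaklySmoothOn * dOp n M +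
          dOp n M * insOp (ofVectorField X) hX.weaklySmoothOn) = 1 := by
  refine LinearMap.ext fun β => SmoothForm.ext ?_
  change ins (ofVectorField X) (d (ins (ofFunction f) β.val)) +
      d (ins (ofVectorField X) (ins (ofFunction f) β.val)) -
    ins (ofFunction f) (ins (ofVectorField X) (d β.val) + d (ins (ofVectorField X) β.val)) = β.val
  refine ext_of_localRep fun x₀ y hy => ?_
  obtain ⟨v, hv, h1⟩ : ∃ v : EuclideanSpace ℝ (Fin n),
      (ofVectorField X).inChart x₀ y = ExteriorAlgebra.ι ℝ v ∧
        fderiv ℝ (f ∘ (extChartAt (𝓡 n) x₀).symm) y v = 1 :=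
    ⟨mfderiv (𝓡 n) 𝓘(ℝ, EuclideanSpace ℝ (Fin n)) (extChartAt (𝓡 n) x₀)
        ((extChartAt (𝓡 n) x₀).symm y) (X ((extChartAt (𝓡 n) x₀).symm y)),
      ExteriorAlgebra.map_apply_ι _ _, (fderiv_comp_symm hf hy _).trans
        ((congrArg _ (mfderiv_symm_mfderiv hy _)).trans (hXf _))⟩
  rw [← ins_ofFunction_comm f (ofVectorField X) β.val, ins_add_right,
    ins_ofFunction_comm f (ofVectorField X) (d β.val), localRep_sub, localRep_add, localRep_add,
    localRep_d_ofFunction hf (β.isSmoothForm.ins hX.weaklySmoothOn) hy, localRep_ins _ _ hy,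
    localRep_d_ofFunction hf β.isSmoothForm hy, map_add, localRep_ins _ β.val hy,
    localRep_ins _ (ins (ofFunction f) (d β.val)) hy, hv, insertion_ι, vectorInsertion_covectorWedge,
    h1, one_smul]
  abel

end Modular

end ModularPoisson

end

open ModularPoisson

theorem proposition3p10 {n : ℕ} {M : Type*} [TopologicalSpace M] [T2Space M]
    [SecondCountableTopology M] [ChartedSpace (EuclideanSpace ℝ (Fin n)) M]
    [IsManifold (𝓡 n) ∞ M]
    (Ω : ModularPoisson.FormField n M) (hΩ : ModularPoisson.IsVolumeForm Ω)
    (P : ModularPoisson.MultiVec n M) (hP : ModularPoisson.IsPoisson P)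
    (Ξ : ∀ x : M, TangentSpace (𝓡 n) x) (hΞ : ModularPoisson.IsModularVectorField Ω P Ξ)
    (ν : M → ℝ) (hν : ContMDiff (𝓡 n) 𝓘(ℝ, ℝ) ∞ ν)
    (hΞν : ∀ x, mvfderiv (𝓡 n) ν x (Ξ x) = 1) :
    -- products of multivector fields are wedge products
    ModularPoisson.IsCompatible P
      (ModularPoisson.ofVectorField Ξ * ModularPoisson.hamiltonian P ν) ∧
    ModularPoisson.lieDer 2
      (ModularPoisson.ofVectorField Ξ * ModularPoisson.hamiltonian P ν) Ω =
        -ModularPoisson.lieDer 2 P Ω ∧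
    (ModularPoisson.IsUnimodular Ω
        (P + ModularPoisson.ofVectorField Ξ * ModularPoisson.hamiltonian P ν) ∧
      ModularPoisson.IsCompatible P
        (P + ModularPoisson.ofVectorField Ξ * ModularPoisson.hamiltonian P ν) ∧
      ModularPoisson.IsCasimir
        (P + ModularPoisson.ofVectorField Ξ * ModularPoisson.hamiltonian P ν) ν) ∧
    ModularPoisson.IsSchouten 2 1 P
      (ModularPoisson.ofFunction ν * ModularPoisson.ofVectorField Ξ)
      (ModularPoisson.hamiltonian P ν * ModularPoisson.ofVectorField Ξ) := by

  -- `p`, `x`, `h`, `N` are `i_P`, `i_Ξ`, `i_{P_ν}` and the multiplication by `ν`; the operators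
  -- `L`, `LX`, `LH`, `K` are the Lie derivatives along `P`, `Ξ`, `P_ν` and `Ξ ∧ P_ν`
  have hX := hΞ.1
  have hH := hP.1.hamiltonian hν
  have hT : IsMultiVectorField 2 (ofVectorField Ξ * hamiltonian P ν) := hX.mul hH
  set dd := dOp n M with hdd
  set p := insOp P hP.1.weaklySmoothOn with hp
  set x := insOp (ofVectorField Ξ) hX.weaklySmoothOn with hx
  set h := insOp (hamiltonian P ν) hH.weaklySmoothOn with hh
  set N := insOp (ofFunction ν : MultiVec n M) (weaklySmoothOn_ofFunction hν) with hN
  obtain ⟨L, hL⟩ : ∃ L, L = p * dd - dd * p := ⟨_, rfl⟩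
  obtain ⟨LX, hLX⟩ : ∃ LX, LX = x * dd + dd * x := ⟨_, rfl⟩
  obtain ⟨LH, hLH⟩ : ∃ LH, LH = h * dd + dd * h := ⟨_, rfl⟩
  obtain ⟨T, hTdef⟩ : ∃ T, T = x * h := ⟨_, rfl⟩
  obtain ⟨K, hK⟩ : ∃ K, K = T * dd - dd * T := ⟨_, rfl⟩
  -- the pointwise relations between the insertion operators
  have hNx : N * x = x * N := LinearMap.ext fun β => SmoothForm.ext (ins_ofFunction_comm ν _ β.val)
  have hpx : p * x = x * p :=
    LinearMap.ext fun β => SmoothForm.ext (ins_comm_of_even hP.1.1 hX.1 β.val)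
  have hph : p * h = h * p :=
    LinearMap.ext fun β => SmoothForm.ext (ins_comm_of_even hP.1.1 hH.1 β.val)
  have hxh : x * h = -(h * x) :=
    LinearMap.ext fun β => SmoothForm.ext (ins_anticomm hX.1 hH.1 β.val)
  have hxx : x * x = 0 := LinearMap.ext fun β => SmoothForm.ext (ins_self hX.1 β.val)
  have hhh : h * h = 0 := LinearMap.ext fun β => SmoothForm.ext (ins_self hH.1 β.val)
  have hTP : T * p = p * T := by
    rw [hTdef, mul_assoc, ← hph, ← mul_assoc, ← hpx, mul_assoc]
  have hTop : insOp _ hT.weaklySmoothOn = T := by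
    rw [hTdef]
    exact LinearMap.ext fun β => SmoothForm.ext (ins_mul _ _ β.val)
  -- the relations involving the exterior derivative
  have hd : dd * dd = 0 := dOp_mul_dOp
  have hLp : L * p = p * L := by
    rw [hL]
    exact isSchouten_self_iff.1 hP.2
  have hLd := lie_anticomm_d hd hL
  have hLL := lie_sq_eq_zero hd hL hLp
  have hLN : L * N - N * L = h := by
    rw [hL]
    exact lie_ofFunction hP.1 hν
  have hLXN : LX * N - N * LX = 1 := by
    rw [hLX]
    exact lie_vectorField_ofFunction hX hν hΞν
  -- on the volume form, `L_P Ω = -i_Ξ Ω` by the definition of `Ξ`; forms of top degree are closed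
  obtain ⟨w, hw⟩ : ∃ w : SmoothForm n M, w.val = Ω := ⟨(⟨Ω, hΩ.1⟩ : smoothForms n M), rfl⟩
  have hdw : dd w = 0 := SmoothForm.ext <| by
    rw [hdd, dOp_val, hw, d_eq_zero_of_top hΩ.2.1]
    rfl
  have hdNw : dd (N w) = 0 := SmoothForm.ext <| by
    rw [hdd, hN, dOp_val, insOp_val, hw, ins_ofFunction, d_eq_zero_of_top]
    · rfl
    · intro y k hk
      rw [Pi.smul_apply, hΩ.2.1 y k hk, smul_zero]
  have hxw : x w = dd (p w) := SmoothForm.ext <| by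
    rw [hx, hdd, hp, dOp_val, insOp_val, insOp_val, hw, hΞ.2]
  have hLw : L w = -x w := by
    rw [hL, LinearMap.sub_apply, Module.End.mul_apply, Module.End.mul_apply, hdw, map_zero, hxw,
      zero_sub]
  -- `⟦P, Ξ⟧ = 0`, because `[L_P, i_Ξ]` maps the volume form to `-L_P (L_P Ω) - i_Ξ (i_Ξ Ω) = 0`
  have hLx : L * x = -(x * L) := by
    have hexp : L * x + x * L = p * dd * x - dd * p * x + (x * (p * dd) - x * (dd * p)) := by
      rw [hL, sub_mul, mul_sub]
    have hLxw : (L * x + x * L) w = 0 := by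
      have h1 := LinearMap.congr_fun hLL w
      have h2 := LinearMap.congr_fun hxx w
      simp only [Module.End.mul_apply, LinearMap.zero_apply, hLw, map_neg] at h1 h2
      rw [LinearMap.add_apply, Module.End.mul_apply, Module.End.mul_apply, hLw, map_neg, h2,
        neg_eq_zero.1 h1, neg_zero, add_zero]
    rw [hexp] at hLxw
    have hΩ0 := congrArg SmoothForm.val hLxw
    have hLxβ : L * x + x * L = 0 := by
      rw [hexp]
      refine LinearMap.ext fun β => SmoothForm.ext ?_
      refine lie_anticomm_of_apply_volumeForm hΩ hP.1 hX ?_ β.isSmoothForm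
      rw [← hw]
      exact hΩ0
    exact eq_neg_of_add_eq_zero_left hLxβ
  have hLh := lie_anticomm_hamiltonian hLL hLN
  have hLXh := lie_comm_hamiltonian (lie_comm_lie hLx hLd hLX) hLXN hLN
  have hLHx := lie_comm_vector hxh hLX hLH hLXh
  have hKexp : K = x * LH - LX * h := by rw [hK, hTdef, lie_mul hLX hLH]
  have hLT : L * T = T * L := by rw [hTdef, lie_comm_mul hLx hLh]
  have hKp : K * p = p * K := lie_comm_symm hTP hL hK hLT
  have hKT : K * T = T * K := by rw [hTdef, lie_mul_comm_mul hxx hhh hxh hKexp hLXh hLHx]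
  -- `L_Ξ Ω = d (d (i_P Ω)) = 0`, and `L_{P_ν} Ω = d (L_P (ν Ω) - ν L_P Ω) = d (ν i_Ξ Ω) = Ω`
  have hLXw : LX w = 0 := by
    rw [hLX, LinearMap.add_apply, Module.End.mul_apply, Module.End.mul_apply, hdw, map_zero, hxw,
      zero_add, ← Module.End.mul_apply, hd, LinearMap.zero_apply]
  have hLHw : LH w = w := by
    have h1 := LinearMap.congr_fun hLN w
    have h2 := LinearMap.congr_fun hLd (N w)
    have h3 := LinearMap.congr_fun hLXN w
    have h4 := LinearMap.congr_fun hNx w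
    have h5 := LinearMap.congr_fun hLX (N w)
    simp only [LinearMap.sub_apply, LinearMap.add_apply, LinearMap.neg_apply, Module.End.mul_apply,
      Module.End.one_apply, hLw, hLXw, hdNw, map_neg, map_zero, sub_zero, sub_neg_eq_add,
      zero_add] at h1 h2 h3 h4 h5
    rw [hLH, LinearMap.add_apply, Module.End.mul_apply, Module.End.mul_apply, hdw, map_zero,
      zero_add, ← h1, map_add, neg_eq_zero.1 h2.symm, zero_add, h4, ← h5, h3]
  have hKw : K w = x w := by
    have h1 := LinearMap.congr_fun hLXh w
    rw [Module.End.mul_apply, Module.End.mul_apply, hLXw, map_zero] at h1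
    rw [hKexp, LinearMap.sub_apply, Module.End.mul_apply, Module.End.mul_apply, hLHw, h1, sub_zero]
  -- from operators back to multivector fields
  have hPT : IsMultiVectorField 2 (P + ofVectorField Ξ * hamiltonian P ν) := hP.1.add hT
  have hPTop : insOp _ hPT.weaklySmoothOn = p + T := by
    rw [← hTop]
    exact LinearMap.ext fun β => SmoothForm.ext (ins_add _ _ β.val)
  have hPPTop : insOp _ (hP.1.add hPT).weaklySmoothOn = p + (p + T) := by
    rw [← hPTop]
    exact LinearMap.ext fun β => SmoothForm.ext (ins_add _ _ β.val)
  have hLK : (p + T) * dd - dd * (p + T) = L + K := by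
    rw [hL, hK]
    noncomm_ring
  have hpp : (p * dd - dd * p) * p = p * (p * dd - dd * p) := by rw [← hL, hLp]
  have hTT : (T * dd - dd * T) * T = T * (T * dd - dd * T) := by rw [← hK, hKT]
  have hPTcomm : ((p + T) * dd - dd * (p + T)) * (p + T) =
      (p + T) * ((p + T) * dd - dd * (p + T)) :=
    lie_comm_add hpp hTT (by rw [← hL, hLT]) (by rw [← hK, hKp])
  have hTPoisson : IsPoisson (ofVectorField Ξ * hamiltonian P ν) :=
    ⟨hT, (isSchouten_self_iff (hQ := hT.weaklySmoothOn)).2 (by rw [hTop, ← hdd, hTT])⟩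
  have hPTPoisson : IsPoisson (P + ofVectorField Ξ * hamiltonian P ν) :=
    ⟨hPT, (isSchouten_self_iff (hQ := hPT.weaklySmoothOn)).2 (by rw [hPTop, ← hdd, hPTcomm])⟩
  have hPPTPoisson : IsPoisson (P + (P + ofVectorField Ξ * hamiltonian P ν)) := by
    refine ⟨hP.1.add hPT, (isSchouten_self_iff (hQ := (hP.1.add hPT).weaklySmoothOn)).2 ?_⟩
    rw [hPPTop, ← hdd]
    refine lie_comm_add hpp hPTcomm ?_ ?_
    · rw [← hL, mul_add, add_mul, hLp, hLT]
    · rw [hLK, mul_add, add_mul, hLp, hKp]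
  have hlieP : lieDer 2 P Ω = -(x w).val := by
    rw [← hw, ← lieDer_two_val (hQ := hP.1.weaklySmoothOn), ← hp, ← hdd, ← hL, hLw]
    rfl
  have hlieT : lieDer 2 (ofVectorField Ξ * hamiltonian P ν) Ω = (x w).val := by
    rw [← hw, ← lieDer_two_val (hQ := hT.weaklySmoothOn), hTop, ← hdd, ← hK, hKw]
  refine ⟨⟨hP, hTPoisson, hPTPoisson⟩, ?_, ⟨⟨hPTPoisson, ?_⟩, ⟨hP, hPTPoisson, hPPTPoisson⟩,
    isCasimir_add hΞν⟩, ?_⟩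
  · rw [hlieT, hlieP, neg_neg]
  · rw [← hw, ← lieDer_two_val (hQ := hPT.weaklySmoothOn), hPTop, ← hdd, hLK, LinearMap.add_apply,
      hLw, hKw, neg_add_cancel]
    rfl
  · intro β hβ
    obtain ⟨b, rfl⟩ : ∃ b : SmoothForm n M, b.val = β := ⟨(⟨β, hβ⟩ : smoothForms n M), rfl⟩
    have hop : h * x = L * (N * x) + N * x * L := by
      linear_combination (norm := noncomm_ring) -hLN * x - N * hLx
    have h1 := congrArg SmoothForm.val (LinearMap.congr_fun hop b)
    rw [hL] at h1
    rw [ins_mul, ins_mul, ins_mul]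
    refine h1.trans ?_
    change ((p * dd - dd * p) (N (x b))).val + ins (ofFunction ν) (ins (ofVectorField Ξ)
      (((p * dd - dd * p) b).val)) = _
    rw [hp, hdd, lieDer_two_val, lieDer_two_val]
    have hs : (-1 : ℝ) ^ ((2 + 1) * 1) = -1 := by norm_num
    have hneg : ∀ a b : FormField n M, a + b = a - (-1 : ℝ) • b := by
      intro a b
      funext y k
      ext v
      simp
    rw [hs]
    exact hneg _ _
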